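/- Let $N\ge 1$ and let $\mathbb G=(\mathbb R^N,\circ)$ be a homogeneous group: a Lie group structure on $\mathbb R^N$ for which, for some $\nu_1,\dots,\nu_N>0$, every dilation $D_\lambda(x)=(\lambda^{\nu_1}x_1,\dots,\lambda^{\nu_N}x_N)$, $\lambda>0$, is a group automorphism. Put $Q=\nu_1+\dots+\nu_N$ and let $|\cdot|$ be a quasi-norm on $\mathbb G$, that is, a continuous function $\mathbb G\to[0,\infty)$ with $|x^{-1}|=|x|$, $|D_\lambda x|=\lambda|x|$ for $\lambda>0$, and $|x|=0\iff x=0$. Let $\mathbb B(0,r)=\{y:|y|<r\}$, let $|E|$ denote the Lebesgue measure of a set $E\subset\mathbb G$, and let $\sigma$ be the Radon measure on the unit sphere $\mathfrak S=\{y:|y|=1\}$ with $\int_{\mathbb G}f(x)\,dx=\int_0^\infty\int_{\mathfrak S}f(D_ry)\,r^{Q-1}\,d\sigma(y)\,dr$; explicitly, $\sigma(A)=Q\,|\{D_ra:a\in A,\ 0<r<1\}|$. Write $|\mathfrak S|=\sigma(\mathfrak S)$. For measurable $h:\mathbb G\to[0,\infty]$ and $x\neq0$ let $$\mathcal G h(x)=\exp\Big(\frac1{|\mathbb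 B(0,|x|)|}\int_{\mathbb B(0,|x|)}\log h(y)\,dy\Big)\in[0,\infty],$$ where $\log 0=-\infty$, $\log\infty=\infty$, $\exp(-\infty)=0$, $\exp(\infty)=\infty$, and the integral is that of the positive part minus that of the negative part, taken to be $+\infty$ whenever the positive part has infinite integral. Let $0<p\le q<\infty$ and let $u,v:\mathbb G\to[0,\infty)$ be measurable. Put $$u_1(x)=\frac1{|\mathfrak S|}\int_{\mathfrak S}u(D_{|x|}y)\,d\sigma(y),\qquad D_Q=\sup_{x\ne0}\ |\mathbb B(0,|x|)|^{\frac1q-\frac1p}\;u_1(x)^{\frac1q}\;\big[\mathcal G(1/v)(x)\big]^{\frac1p},$$ with $1/0=\infty$ and $0\cdot\infty=0$. If $D_Q<\infty$, then there is a constant $0<C<\infty$ such that $$\Big(\int_{\mathbb G}[\mathcal G f(x)]^q\,u(x)\,dx\Big)^{1/q}\le C\Big(\int_{\mathbb G}f(x)^p\,v(x)\,dx\Big)^{1/p}$$ for all measurable $f:\mathbb G\to(0,\infty)$ (both sides being allowed to be infinite). Moreover, the optimal constant $C_{\mathrm{opt}}$, the infimum of all such $C$, satisfies $$C_{\mathrm{opt}}\le\Big(\frac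 pq\Big)^{1/q}e^{1/p}\,D_Q,$$ and $C_{\mathrm{opt}}>0$ if in addition $u(x)>0$ for all $x$ and $D_Q>0$. -/

import Mathlib

open MeasureTheory
open scoped ENNReal NNReal Manifold ContDiff

noncomputable section

/-- A homogeneous group structure on `ℝ^N`: `ℝ^N` (with its usual smooth structure) is a Lie group
and the anisotropic dilations with exponents `expo i > 0` are automorphisms of it. -/
structure HomogeneousGroup (N : ℕ) [Group (EuclideanSpace ℝ (Fin N))]
    [LieGroup 𝓘(ℝ, EuclideanSpace ℝ (Fin N)) ∞ (EuclideanSpace ℝ (Fin N))] where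
  /-- the dilation exponents -/
  expo : Fin N → ℝ
  expo_pos : ∀ i, 0 < expo i
  dil_mul : ∀ (r : ℝ) (x y : EuclideanSpace ℝ (Fin N)), 0 < r →
    WithLp.toLp 2 (fun i => r ^ expo i * (x * y) i) =
      (WithLp.toLp 2 (fun i => r ^ expo i * x i) * WithLp.toLp 2 (fun i => r ^ expo i * y i) :
        EuclideanSpace ℝ (Fin N))

namespace HomogeneousGroup

variable {N : ℕ} [Group (EuclideanSpace ℝ (Fin N))]
  [LieGroup 𝓘(ℝ, EuclideanSpace ℝ (Fin N)) ∞ (EuclideanSpace ℝ (Fin N))]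

/-- The dilation `D_r x = (r^{ν₁} x₁, …, r^{ν_N} x_N)` (used for `r > 0`). -/
def dil (G : HomogeneousGroup N) (r : ℝ) (x : EuclideanSpace ℝ (Fin N)) :
    EuclideanSpace ℝ (Fin N) :=
  WithLp.toLp 2 (fun i => r ^ G.expo i * x i)

/-- The homogeneous dimension. -/
def homDim (G : HomogeneousGroup N) : ℝ := ∑ i, G.expo i

/-- A (homogeneous, symmetric, continuous) quasi-norm on a homogeneous group. -/
structure QuasiNorm (G : HomogeneousGroup N) where
  /-- the underlying function -/
  toFun : EuclideanSpace ℝ (Fin N) → ℝ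
  continuous_toFun : Continuous toFun
  nonneg : ∀ x, 0 ≤ toFun x
  map_inv : ∀ x, toFun x⁻¹ = toFun x
  map_dil : ∀ (r : ℝ) (x : EuclideanSpace ℝ (Fin N)), 0 < r → toFun (G.dil r x) = r * toFun x
  eq_zero_iff : ∀ x, toFun x = 0 ↔ x = 0

end HomogeneousGroup

namespace HomogeneousGroup.QuasiNorm

variable {N : ℕ} [Group (EuclideanSpace ℝ (Fin N))]
  [LieGroup 𝓘(ℝ, EuclideanSpace ℝ (Fin N)) ∞ (EuclideanSpace ℝ (Fin N))]
  {G : HomogeneousGroup N}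

/-- The quasi-ball of radius `r` centred at the origin. -/
def ball (ρ : G.QuasiNorm) (r : ℝ) : Set (EuclideanSpace ℝ (Fin N)) := {y | ρ.toFun y < r}

/-- The unit quasi-sphere. -/
def sphere (ρ : G.QuasiNorm) : Set (EuclideanSpace ℝ (Fin N)) := {y | ρ.toFun y = 1}

/-- The polar surface measure `σ`, as a measure on `ℝ^N` carried by the unit quasi-sphere:
`σ A` is `Q` times the Lebesgue measure of the truncated cone `{D_r a : a ∈ A, 0 < r < 1}`.
See `lintegral_polar` for the polar decomposition of Lebesgue measure that determines it. -/
def sphereMeasure (ρ : G.QuasiNorm) : Measure (EuclideanSpace ℝ (Fin N)) :=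
  ENNReal.ofReal G.homDim •
    (volume.restrict {y | 0 < ρ.toFun y ∧ ρ.toFun y < 1}).map
      (fun y => G.dil (ρ.toFun y)⁻¹ y)


theorem dil_dil (G : HomogeneousGroup N) {r t : ℝ} (hr : 0 < r) (ht : 0 < t)
    (x : EuclideanSpace ℝ (Fin N)) : G.dil r (G.dil t x) = G.dil (r * t) x := by
  ext i
  simp [HomogeneousGroup.dil, Real.mul_rpow hr.le ht.le, mul_assoc]

theorem dil_one (G : HomogeneousGroup N) (x : EuclideanSpace ℝ (Fin N)) : G.dil 1 x = x := by
  ext i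
  simp [HomogeneousGroup.dil]

theorem measurable_dil (G : HomogeneousGroup N) :
    Measurable (fun z : ℝ × EuclideanSpace ℝ (Fin N) => G.dil z.1 z.2) := by
  unfold HomogeneousGroup.dil
  refine (WithLp.measurable_toLp 2 _).comp (measurable_pi_lambda _ fun i => ?_)
  fun_prop

theorem homDim_pos (hN : 0 < N) (G : HomogeneousGroup N) : 0 < G.homDim := by
  have : Nonempty (Fin N) := ⟨⟨0, hN⟩⟩
  exact Finset.sum_pos (fun i _ => G.expo_pos i) Finset.univ_nonempty

/-- Lebesgue measure is homogeneous of degree `Q` under dilations. -/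
theorem lintegral_dil (G : HomogeneousGroup N) {t : ℝ} (ht : 0 < t)
    {F : EuclideanSpace ℝ (Fin N) → ℝ≥0∞} (hF : Measurable F) :
    ∫⁻ x, F (G.dil t x) = ENNReal.ofReal (t ^ (-G.homDim)) * ∫⁻ x, F x := by
  let L : EuclideanSpace ℝ (Fin N) →ₗ[ℝ] EuclideanSpace ℝ (Fin N) :=
    Matrix.toEuclideanLin (Matrix.diagonal fun i => t ^ G.expo i)
  have hL : ∀ x, L x = G.dil t x := by
    intro x
    ext i
    simp [L, HomogeneousGroup.dil, Matrix.mulVec_diagonal, Matrix.toLpLin_apply]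
  have hdet : LinearMap.det L = t ^ G.homDim := by
    have : LinearMap.det L = (Matrix.diagonal fun i => t ^ G.expo i).det := by
      simp only [L, Matrix.toLpLin_eq_toLin, LinearMap.det_toLin]
    rw [this, Matrix.det_diagonal, HomogeneousGroup.homDim, Real.rpow_sum_of_pos ht]
  have hpos : 0 < t ^ G.homDim := Real.rpow_pos_of_pos ht _
  have hmap := Measure.map_linearMap_addHaar_eq_smul_addHaar
    (volume : Measure (EuclideanSpace ℝ (Fin N))) (f := L) (by rw [hdet]; exact hpos.ne')
  have hm : Measurable (fun x => L x) := L.continuous_of_finiteDimensional.measurable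
  calc ∫⁻ x, F (G.dil t x) = ∫⁻ x, F (L x) := by simp_rw [hL]
    _ = ∫⁻ x, F x ∂(Measure.map L volume) := (lintegral_map hF hm).symm
    _ = _ := by
      rw [hmap, lintegral_smul_measure, hdet, Real.rpow_neg ht.le, abs_of_pos (inv_pos.2 hpos),
        smul_eq_mul]

theorem measurable_proj (ρ : G.QuasiNorm) :
    Measurable (fun y => G.dil (ρ.toFun y)⁻¹ y) :=
  (measurable_dil G).comp (ρ.continuous_toFun.measurable.inv.prodMk measurable_id)

theorem measurableSet_punctured (ρ : G.QuasiNorm) :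
    MeasurableSet {y | 0 < ρ.toFun y ∧ ρ.toFun y < 1} :=
  (measurableSet_lt measurable_const ρ.continuous_toFun.measurable).inter
    (measurableSet_lt ρ.continuous_toFun.measurable measurable_const)

/-- `∫_𝔖 F dσ` written out as an integral over the punctured unit quasi-ball. -/
theorem lintegral_sphereMeasure (ρ : G.QuasiNorm) {F : EuclideanSpace ℝ (Fin N) → ℝ≥0∞}
    (hF : Measurable F) :
    ∫⁻ y in ρ.sphere, F y ∂ρ.sphereMeasure = ENNReal.ofReal G.homDim *
      ∫⁻ y in {y | 0 < ρ.toFun y ∧ ρ.toFun y < 1}, F (G.dil (ρ.toFun y)⁻¹ y) := by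
  have hS : MeasurableSet ρ.sphere :=
    measurableSet_eq_fun ρ.continuous_toFun.measurable measurable_const
  rw [← lintegral_indicator hS, sphereMeasure, lintegral_smul_measure,
    lintegral_map (hF.indicator hS) (measurable_proj ρ), smul_eq_mul]
  congr 1
  refine setLIntegral_congr_fun (measurableSet_punctured ρ) fun y hy => ?_
  refine Set.indicator_of_mem ?_ F
  change ρ.toFun _ = 1
  rw [ρ.map_dil _ _ (inv_pos.2 hy.1), inv_mul_cancel₀ hy.1.ne']

theorem lintegral_Ioi_scale {m : ℝ} (hm : 0 < m) {H : ℝ → ℝ≥0∞} (hH : Measurable H) :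
    ∫⁻ r in Set.Ioi (0 : ℝ), H r = ∫⁻ t in Set.Ioi (0 : ℝ), ENNReal.ofReal m * H (m * t) := by
  rw [lintegral_const_mul _ (by fun_prop), ← lintegral_indicator measurableSet_Ioi,
    ← lintegral_indicator measurableSet_Ioi]
  conv_lhs => rw [← Real.smul_map_volume_mul_left hm.ne']
  rw [lintegral_smul_measure, lintegral_map (hH.indicator measurableSet_Ioi) (by fun_prop),
    smul_eq_mul, abs_of_pos hm]
  congr 2 with t
  by_cases ht : 0 < t
  · rw [Set.indicator_of_mem (show m * t ∈ Set.Ioi (0 : ℝ) from mul_pos hm ht),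
      Set.indicator_of_mem (show t ∈ Set.Ioi (0 : ℝ) from ht)]
  · rw [Set.indicator_of_notMem (s := Set.Ioi (0 : ℝ)) (a := m * t)
        (fun h => ht (pos_of_mul_pos_right h hm.le)),
      Set.indicator_of_notMem (s := Set.Ioi (0 : ℝ)) (a := t) ht]

theorem lintegral_Ioi_neg_rpow {Q m : ℝ} (hQ : 0 < Q) (hm : 0 < m) :
    ∫⁻ t in Set.Ioi m, ENNReal.ofReal (t ^ (-Q - 1)) = ENNReal.ofReal (m ^ (-Q) / Q) := by
  rw [← ofReal_integral_eq_lintegral_ofReal (integrableOn_Ioi_rpow_of_lt (by linarith) hm),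
    integral_Ioi_rpow_of_lt (by linarith) hm]
  · congr 1
    rw [sub_add_cancel, neg_div_neg_eq]
  · filter_upwards [ae_restrict_mem measurableSet_Ioi] with t ht
    exact Real.rpow_nonneg (hm.trans ht).le _

/-- Polar decomposition of Lebesgue measure with respect to `sphereMeasure`. -/
theorem lintegral_polar (hN : 0 < N) (ρ : G.QuasiNorm) {F : EuclideanSpace ℝ (Fin N) → ℝ≥0∞}
    (hF : Measurable F) :
    ∫⁻ x, F x = ∫⁻ r in Set.Ioi (0 : ℝ), ∫⁻ y in ρ.sphere,
      F (G.dil r y) * ENNReal.ofReal (r ^ (G.homDim - 1)) ∂ρ.sphereMeasure := by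
  have hQ := homDim_pos hN G
  set Q := G.homDim with hQdef
  set n := ρ.toFun with hn
  have hnm : Measurable n := ρ.continuous_toFun.measurable
  have hdil := measurable_dil G
  set A : Set (EuclideanSpace ℝ (Fin N)) := {y | 0 < n y ∧ n y < 1} with hA
  have hAm : MeasurableSet A := measurableSet_punctured ρ
  have hdilr : ∀ r, Measurable (G.dil r) := fun r =>
    hdil.comp (measurable_const.prodMk measurable_id)
  have hFd : Measurable (fun z : ℝ × EuclideanSpace ℝ (Fin N) => F (G.dil z.1 z.2)) :=
    hF.comp hdil
  let B : Set (ℝ × EuclideanSpace ℝ (Fin N)) := {z | 0 < n z.2 ∧ n z.2 < z.1}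
  have hBm : MeasurableSet B :=
    (measurableSet_lt measurable_const (hnm.comp measurable_snd)).inter
      (measurableSet_lt (hnm.comp measurable_snd) measurable_fst)
  let K : ℝ × EuclideanSpace ℝ (Fin N) → ℝ≥0∞ :=
    B.indicator fun z => F z.2 * ENNReal.ofReal (n z.2 ^ Q * z.1 ^ (-Q - 1))
  have hKm : Measurable K := Measurable.indicator (by fun_prop) hBm
  symm
  calc ∫⁻ r in Set.Ioi (0 : ℝ), ∫⁻ y in ρ.sphere,
        F (G.dil r y) * ENNReal.ofReal (r ^ (Q - 1)) ∂ρ.sphereMeasure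
      = ∫⁻ r in Set.Ioi (0 : ℝ), ENNReal.ofReal Q * ∫⁻ z in A,
          F (G.dil r (G.dil (n z)⁻¹ z)) * ENNReal.ofReal (r ^ (Q - 1)) := by
        refine lintegral_congr fun r => ?_
        exact lintegral_sphereMeasure ρ ((hF.comp (hdilr r)).mul_const _)
    _ = ENNReal.ofReal Q * ∫⁻ r in Set.Ioi (0 : ℝ), ∫⁻ z in A,
          F (G.dil r (G.dil (n z)⁻¹ z)) * ENNReal.ofReal (r ^ (Q - 1)) :=
        lintegral_const_mul' _ _ ENNReal.ofReal_ne_top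
    _ = ENNReal.ofReal Q * ∫⁻ z in A, ∫⁻ r in Set.Ioi (0 : ℝ),
          F (G.dil r (G.dil (n z)⁻¹ z)) * ENNReal.ofReal (r ^ (Q - 1)) := by
        congr 1
        refine lintegral_lintegral_swap (Measurable.aemeasurable ?_)
        refine Measurable.mul ?_ (by fun_prop)
        exact hF.comp (hdil.comp (measurable_fst.prodMk
          ((measurable_proj ρ).comp measurable_snd)))
    _ = ENNReal.ofReal Q * ∫⁻ z in A, ∫⁻ t in Set.Ioi (0 : ℝ),
          F (G.dil t z) * ENNReal.ofReal (n z ^ Q * t ^ (Q - 1)) := by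
        congr 1
        refine setLIntegral_congr_fun hAm fun z hz => ?_
        have hz0 : 0 < n z := hz.1
        rw [lintegral_Ioi_scale hz0]
        · refine setLIntegral_congr_fun measurableSet_Ioi fun t ht => ?_
          have ht0 : (0 : ℝ) < t := ht
          rw [dil_dil G (mul_pos hz0 ht0) (inv_pos.2 hz0), mul_comm (n z) t,
            mul_inv_cancel_right₀ hz0.ne', mul_left_comm, ← ENNReal.ofReal_mul hz0.le,
            Real.mul_rpow ht0.le hz0.le, Real.rpow_sub_one hz0.ne']
          congr 2
          field_simp
        · exact (hF.comp (hdil.comp (measurable_id.prodMk measurable_const))).mul (by fun_prop)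
    _ = ENNReal.ofReal Q * ∫⁻ t in Set.Ioi (0 : ℝ), ∫⁻ z in A,
          F (G.dil t z) * ENNReal.ofReal (n z ^ Q * t ^ (Q - 1)) := by
        congr 1
        refine lintegral_lintegral_swap (Measurable.aemeasurable ?_)
        refine Measurable.mul ?_ (by fun_prop)
        exact hF.comp (hdil.comp (measurable_snd.prodMk measurable_fst))
    _ = ENNReal.ofReal Q * ∫⁻ t in Set.Ioi (0 : ℝ), ∫⁻ w, K (t, w) := by
        congr 1
        refine setLIntegral_congr_fun measurableSet_Ioi fun t ht => ?_
        have ht0 : (0 : ℝ) < t := ht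
        have htQ : (0 : ℝ) < t ^ Q := Real.rpow_pos_of_pos ht0 _
        have hKt : Measurable fun w => K (t, w) := hKm.comp (measurable_const.prodMk measurable_id)
        have key : ∫⁻ w, K (t, w) = ENNReal.ofReal (t ^ Q) * ∫⁻ z, K (t, G.dil t z) := by
          rw [lintegral_dil G ht0 hKt, ← mul_assoc, ← ENNReal.ofReal_mul htQ.le, ← hQdef,
            ← Real.rpow_add ht0, add_neg_cancel, Real.rpow_zero, ENNReal.ofReal_one, one_mul]
        rw [key, ← lintegral_const_mul' _ _ ENNReal.ofReal_ne_top, ← lintegral_indicator hAm]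
        refine lintegral_congr fun z => ?_
        have hnz : n (G.dil t z) = t * n z := ρ.map_dil t z ht0
        by_cases hz : z ∈ A
        · have hz' : (t, G.dil t z) ∈ B := by
            change 0 < n (G.dil t z) ∧ n (G.dil t z) < t
            rw [hnz]
            exact ⟨mul_pos ht0 hz.1, mul_lt_of_lt_one_right ht0 hz.2⟩
          rw [Set.indicator_of_mem hz, show K (t, G.dil t z) = _ from Set.indicator_of_mem hz' _]
          dsimp only
          rw [hnz, mul_left_comm, ← ENNReal.ofReal_mul htQ.le, Real.mul_rpow ht0.le hz.1.le,
            Real.rpow_sub_one ht0.ne', Real.rpow_sub_one ht0.ne', Real.rpow_neg ht0.le]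
          congr 2
          field_simp
        · have hz' : (t, G.dil t z) ∉ B := by
            rintro ⟨h1, h2⟩
            change 0 < n (G.dil t z) at h1
            change n (G.dil t z) < t at h2
            rw [hnz] at h1 h2
            exact hz ⟨pos_of_mul_pos_right h1 ht0.le, by
              by_contra h
              nlinarith [not_lt.1 h]⟩
          rw [Set.indicator_of_notMem hz,
            show K (t, G.dil t z) = 0 from Set.indicator_of_notMem hz' _, mul_zero]
    _ = ENNReal.ofReal Q * ∫⁻ w, ∫⁻ t in Set.Ioi (0 : ℝ), K (t, w) := by
        congr 1
        exact lintegral_lintegral_swap hKm.aemeasurable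
    _ = ∫⁻ w, ENNReal.ofReal Q * ∫⁻ t in Set.Ioi (0 : ℝ), K (t, w) :=
        (lintegral_const_mul' _ _ ENNReal.ofReal_ne_top).symm
    _ = ∫⁻ w, F w := by
        have : Nontrivial (EuclideanSpace ℝ (Fin N)) := by
          have : Nonempty (Fin N) := ⟨⟨0, hN⟩⟩
          infer_instance
        have h0 : ∀ᵐ w : EuclideanSpace ℝ (Fin N), w ≠ 0 := by
          rw [ae_iff]
          simp
        refine lintegral_congr_ae (h0.mono fun w hw => ?_)
        have hw0 : 0 < n w := lt_of_le_of_ne (ρ.nonneg w) fun h => hw ((ρ.eq_zero_iff w).1 h.symm)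
        have hwQ : (0 : ℝ) < n w ^ Q := Real.rpow_pos_of_pos hw0 _
        have e1 : ∫⁻ t in Set.Ioi (0 : ℝ), K (t, w) =
            ∫⁻ t in Set.Ioi (n w), F w * ENNReal.ofReal (n w ^ Q) *
              ENNReal.ofReal (t ^ (-Q - 1)) := by
          rw [← lintegral_indicator measurableSet_Ioi, ← lintegral_indicator measurableSet_Ioi]
          refine lintegral_congr fun t => ?_
          by_cases ht : n w < t
          · have hB : (t, w) ∈ B := ⟨hw0, ht⟩
            rw [Set.indicator_of_mem (show t ∈ Set.Ioi (0 : ℝ) from hw0.trans ht),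
              Set.indicator_of_mem (show t ∈ Set.Ioi (n w) from ht),
              show K (t, w) = _ from Set.indicator_of_mem hB _, ENNReal.ofReal_mul hwQ.le,
              mul_assoc]
          · have hB : (t, w) ∉ B := fun h => ht h.2
            rw [Set.indicator_of_notMem (s := Set.Ioi (n w)) ht, Set.indicator_apply,
              show K (t, w) = 0 from Set.indicator_of_notMem hB _, ite_self]
        dsimp only
        rw [e1, lintegral_const_mul _ (by fun_prop), lintegral_Ioi_neg_rpow hQ hw0, mul_assoc,
          mul_left_comm, ← ENNReal.ofReal_mul hwQ.le, ← ENNReal.ofReal_mul hQ.le,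
          Real.rpow_neg hw0.le]
        have : Q * (n w ^ Q * ((n w ^ Q)⁻¹ / Q)) = 1 := by field_simp
        rw [this, ENNReal.ofReal_one, mul_one]

/-- The spherical average `u₁(x) = |𝔖|⁻¹ ∫_𝔖 u(|x| y) dσ(y)`. -/
def sphericalAverage (ρ : G.QuasiNorm) (u : EuclideanSpace ℝ (Fin N) → ℝ≥0)
    (x : EuclideanSpace ℝ (Fin N)) : ℝ≥0∞ :=
  (ρ.sphereMeasure ρ.sphere)⁻¹ *
    ∫⁻ y in ρ.sphere, (u (G.dil (ρ.toFun x) y) : ℝ≥0∞) ∂ρ.sphereMeasure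

/-- The integral `∫_s log h ∈ [-∞, ∞]`, i.e. the integral of the positive part minus the integral
of the negative part. It is `+∞` as soon as the positive part has infinite integral (this includes
the indeterminate case `∞ - ∞`); here `log 0 = -∞` and `log ∞ = ∞`. -/
def logIntegral (s : Set (EuclideanSpace ℝ (Fin N))) (h : EuclideanSpace ℝ (Fin N) → ℝ≥0∞) :
    EReal :=
  open scoped Classical in
  if ∫⁻ y in s, (ENNReal.log (h y)).toENNReal = ⊤ then ⊤
  else ((∫⁻ y in s, (ENNReal.log (h y)).toENNReal : ℝ≥0∞) : EReal) -
    ((∫⁻ y in s, (-ENNReal.log (h y)).toENNReal : ℝ≥0∞) : EReal)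

/-- The geometric mean `exp (|B(0,|x|)|⁻¹ ∫_{B(0,|x|)} log h) ∈ [0, ∞]`. -/
def geomMean (ρ : G.QuasiNorm) (h : EuclideanSpace ℝ (Fin N) → ℝ≥0∞)
    (x : EuclideanSpace ℝ (Fin N)) : ℝ≥0∞ :=
  EReal.exp (logIntegral (ρ.ball (ρ.toFun x)) h / (volume (ρ.ball (ρ.toFun x)) : EReal))

/-- The quantity `D_Q ∈ [0, ∞]`; the supremum is over `x ≠ 0`, where `|B(0,|x|)| > 0`. -/
def weightConst (ρ : G.QuasiNorm) (p q : ℝ) (u v : EuclideanSpace ℝ (Fin N) → ℝ≥0) : ℝ≥0∞ :=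
  ⨆ (x : EuclideanSpace ℝ (Fin N)) (_ : x ≠ 0),
    volume (ρ.ball (ρ.toFun x)) ^ (1 / q - 1 / p) * ρ.sphericalAverage u x ^ (1 / q) *
      ρ.geomMean (fun y => 1 / (v y : ℝ≥0∞)) x ^ (1 / p)

/-- The weighted inequality for the geometric mean operator with constant `C`:
`(∫ (geomMean f)^q u)^{1/q} ≤ C (∫ f^p v)^{1/p}` for all positive measurable `f`. -/
def GeomMeanInequality (ρ : G.QuasiNorm) (p q : ℝ) (u v : EuclideanSpace ℝ (Fin N) → ℝ≥0)
    (C : ℝ≥0) : Prop :=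
  ∀ f : EuclideanSpace ℝ (Fin N) → ℝ≥0, Measurable f → (∀ x, 0 < f x) →
    (∫⁻ x, ρ.geomMean (fun y => (f y : ℝ≥0∞)) x ^ q * (u x : ℝ≥0∞)) ^ (1 / q) ≤
      (C : ℝ≥0∞) * (∫⁻ x, (f x : ℝ≥0∞) ^ p * (v x : ℝ≥0∞)) ^ (1 / p)

/-- The optimal constant: the infimum of all admissible positive constants
(`∞` if there are none). -/
def optimalConst (ρ : G.QuasiNorm) (p q : ℝ) (u v : EuclideanSpace ℝ (Fin N) → ℝ≥0) : ℝ≥0∞ :=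
  ⨅ (C : ℝ≥0) (_ : 0 < C ∧ ρ.GeomMeanInequality p q u v C), (C : ℝ≥0∞)

end HomogeneousGroup.QuasiNorm

end

/-!
Write `w(x) = |B(0,|x|)|`, `g = f ^ p * v`, `s = q / p` and `B_x = B(0,|x|)`.

Pointwise bound. Since `p log f = log (g w / w(x)) + log (1 / v) + log (w(x) / w)`, and the last
term has mean value exactly one over `B_x` (`lintegral_ball_log`), Jensen's inequality gives
`(𝒢 f)(x) ^ p ≤ 𝒢(1/v)(x) * e * w(x)⁻² * ∫_{B_x} w g` (`ballMean_rpow_le`). Jensen's inequality is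
used in the form `log H ≤ H / c - 1 + log c`, integrated separately for the positive and the
negative parts, so that infinite integrals of logarithms need no special treatment except when
`𝒢(1/v)(x) = ∞`. There `D_Q < ∞` forces `u₁(x) = 0`.

Reduction to a Hardy inequality. As `𝒢 f` is radial, `u` may be replaced by `u₁`
(`lintegral_radial_mul`), and the definition of `D_Q` then bounds `∫ (𝒢 f) ^ q u` by
`D_Q ^ q e ^ s ∫ w ^ (-s - 1) (∫_{B_x} w g) ^ s`.

Hardy inequality. The last integral is at most `s⁻¹ (∫ g) ^ s` (`hardy_lintegral_le`), which is the
integral Minkowski inequality combined with `∫_{w > a} w ^ (-s - 1) = a ^ (-s) / s`. This gives the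
constant `(p / q) ^ (1 / q) e ^ (1 / p) D_Q`.

Positivity of the optimal constant. If `D_Q > 0` and `u > 0`, then `0 < 𝒢(1/v) < ∞` at some
`x ≠ 0`. A function equal to `v ^ (-1 / p)` on `B_x` and to `(w ^ 2 v) ^ (-1 / p)` outside makes the
right-hand side finite and the left-hand side positive (`exists_testFunction`).
-/

/-! ### A Hardy inequality with respect to the sublevel sets of a weight -/

theorem lintegral_mul_setLIntegral_lt_swap {α : Type*} [MeasurableSpace α] {μ : Measure α}
    [SFinite μ] {w φ F : α → ℝ≥0∞} (hw : Measurable w) (hφ : Measurable φ) (hF : Measurable F) :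
    ∫⁻ x, φ x * ∫⁻ y in {y | w y < w x}, F y ∂μ ∂μ =
      ∫⁻ y, F y * ∫⁻ x in {x | w y < w x}, φ x ∂μ ∂μ := by
  have hB : MeasurableSet {z : α × α | w z.2 < w z.1} :=
    measurableSet_lt (hw.comp measurable_snd) (hw.comp measurable_fst)
  have h1 : ∀ x, MeasurableSet {y | w y < w x} := fun x => measurableSet_lt hw measurable_const
  have h2 : ∀ y, MeasurableSet {x | w y < w x} := fun y => measurableSet_lt measurable_const hw
  let K : α × α → ℝ≥0∞ := {z : α × α | w z.2 < w z.1}.indicator fun z => φ z.1 * F z.2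
  have hK : Measurable K := Measurable.indicator (by fun_prop) hB
  calc ∫⁻ x, φ x * ∫⁻ y in {y | w y < w x}, F y ∂μ ∂μ
      = ∫⁻ x, ∫⁻ y, K (x, y) ∂μ ∂μ := by
        refine lintegral_congr fun x => ?_
        rw [← lintegral_const_mul _ hF, ← lintegral_indicator (h1 x)]
        rfl
    _ = ∫⁻ y, ∫⁻ x, K (x, y) ∂μ ∂μ := lintegral_lintegral_swap hK.aemeasurable
    _ = _ := by
        refine lintegral_congr fun y => ?_
        rw [← lintegral_const_mul _ hφ, ← lintegral_indicator (h2 y)]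
        refine lintegral_congr fun x => ?_
        simp only [K, Set.indicator_apply, Set.mem_ofPred_eq, mul_comm]

theorem measurable_setLIntegral_lt {α : Type*} [MeasurableSpace α] {μ : Measure α}
    [SFinite μ] {w F : α → ℝ≥0∞} (hw : Measurable w) (hF : Measurable F) :
    Measurable fun x => ∫⁻ y in {y | w y < w x}, F y ∂μ := by
  have hB : MeasurableSet {z : α × α | w z.2 < w z.1} :=
    measurableSet_lt (hw.comp measurable_snd) (hw.comp measurable_fst)
  have h1 : ∀ x, MeasurableSet {y | w y < w x} := fun x => measurableSet_lt hw measurable_const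
  simp_rw [← lintegral_indicator (h1 _)]
  exact Measurable.lintegral_prod_right'
    (f := {z : α × α | w z.2 < w z.1}.indicator fun z => F z.2)
    (Measurable.indicator (by fun_prop) hB)

/-- Hardy's inequality over the sublevel sets of a weight `w` whose tail integrals are at most those of
the identity on `(0, ∞)`, with the constant `1 / s` of Minkowski's integral inequality. -/
theorem hardy_lintegral_le {α : Type*} [MeasurableSpace α] {μ : Measure α} [SFinite μ]
    {w g : α → ℝ≥0∞} (hw : Measurable w) (hg : Measurable g)
    (hw0 : ∀ᵐ x ∂μ, w x ≠ 0) (hwt : ∀ x, w x ≠ ⊤) {s : ℝ} (hs : 1 ≤ s)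
    (htail : ∀ t : ℝ, 1 ≤ t → ∀ y, w y ≠ 0 →
      ∫⁻ x in {x | w y < w x}, w x ^ (-t - 1) ∂μ ≤ w y ^ (-t) * (ENNReal.ofReal t)⁻¹) :
    ∫⁻ x, w x ^ (-s - 1) * (∫⁻ y in {y | w y < w x}, w y * g y ∂μ) ^ s ∂μ ≤
      (ENNReal.ofReal s)⁻¹ * (∫⁻ y, g y ∂μ) ^ s := by
  have hs0 : 0 < s := by linarith
  set I := ∫⁻ y, g y ∂μ with hI
  rcases eq_or_ne I ⊤ with hIt | hIt
  · rw [hIt, ENNReal.top_rpow_of_pos hs0, ENNReal.mul_top (by simp)]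
    exact le_top
  set T : α → ℝ≥0∞ := fun x => ∫⁻ y in {y | w y < w x}, w y * g y ∂μ with hT
  have hTm : Measurable T := measurable_setLIntegral_lt hw (hw.mul hg)
  have hTle : ∀ x, T x ≤ w x * I := fun x => by
    calc T x ≤ ∫⁻ y in {y | w y < w x}, w x * g y ∂μ := by
          refine setLIntegral_mono (by fun_prop) fun y hy => ?_
          exact mul_le_mul_left (le_of_lt hy) _
      _ = w x * ∫⁻ y in {y | w y < w x}, g y ∂μ := lintegral_const_mul _ hg
      _ ≤ w x * I := by gcongr; exact setLIntegral_le_lintegral _ _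
  set A := ∫⁻ x, w x ^ (-s - 1) * T x ^ s ∂μ with hA
  -- After exchanging the integrals, a tail bound for `φ` is integrated against `w g`.
  have hint : ∀ (φ : α → ℝ≥0∞) (c : ℝ≥0∞), Measurable φ →
      (∀ y, w y ≠ 0 → ∫⁻ x in {x | w y < w x}, φ x ∂μ ≤ (w y)⁻¹ * c) →
      ∫⁻ x, φ x * T x ∂μ ≤ I * c := fun φ c hφ hb => by
    refine (lintegral_mul_setLIntegral_lt_swap hw hφ (F := fun y => w y * g y)
      (hw.mul hg)).trans_le ?_
    rw [hI, ← lintegral_mul_const _ hg]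
    refine lintegral_mono fun y => ?_
    rcases eq_or_ne (w y) 0 with h0 | h0
    · simp [h0]
    · calc w y * g y * ∫⁻ x in {x | w y < w x}, φ x ∂μ ≤ w y * g y * ((w y)⁻¹ * c) := by
            gcongr; exact hb y h0
        _ = (w y * (w y)⁻¹) * (g y * c) := by ring
        _ = g y * c := by rw [ENNReal.mul_inv_cancel h0 (hwt y), one_mul]
  have hsplit : ∀ x, T x ^ s = T x ^ (s - 1) * T x := fun x => by
    conv_lhs => rw [← sub_add_cancel s 1]
    rw [ENNReal.rpow_add_of_nonneg _ _ (by linarith) zero_le_one, ENNReal.rpow_one]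
  -- A bound with the worse constant `1`. It settles `s = 1`, and for `s > 1` it shows `A < ∞`, so
  -- that a power of `A` can be cancelled below.
  have hcrude : A ≤ I ^ s := by
    calc A ≤ ∫⁻ x, I ^ (s - 1) * (w x ^ (-1 - 1 : ℝ) * T x) ∂μ := by
          refine lintegral_mono_ae (hw0.mono fun x hx => ?_)
          rw [hsplit]
          calc w x ^ (-s - 1) * (T x ^ (s - 1) * T x)
              ≤ w x ^ (-s - 1) * ((w x * I) ^ (s - 1) * T x) := by
                gcongr
                exact hTle x
            _ = I ^ (s - 1) * ((w x ^ (-s - 1) * w x ^ (s - 1)) * T x) := by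
                rw [ENNReal.mul_rpow_of_nonneg _ _ (by linarith)]; ring
            _ = _ := by
                rw [← ENNReal.rpow_add _ _ hx (hwt x)]
                ring_nf
      _ = I ^ (s - 1) * ∫⁻ x, w x ^ (-1 - 1 : ℝ) * T x ∂μ :=
          lintegral_const_mul _ (by fun_prop)
      _ ≤ I ^ (s - 1) * (I * 1) := by
          gcongr
          refine hint _ _ (by fun_prop) fun y hy => ?_
          simpa [ENNReal.rpow_neg_one] using htail 1 le_rfl y hy
      _ = I ^ s := by
          rw [mul_one]
          conv_rhs => rw [← sub_add_cancel s 1]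
          rw [ENNReal.rpow_add_of_nonneg _ _ (by linarith) zero_le_one, ENNReal.rpow_one]
  rcases hs.eq_or_lt with rfl | hs1
  · simpa using hcrude
  have hAt : A ≠ ⊤ := ne_top_of_le_ne_top (ENNReal.rpow_ne_top_of_nonneg hs0.le hIt) hcrude
  rcases eq_or_ne A 0 with hA0 | hA0
  · rw [hA0]; exact zero_le
  have hconj : (s / (s - 1)).HolderConjugate s :=
    (Real.HolderConjugate.conjExponent hs1).symm
  have hs1' : s - 1 ≠ 0 := by linarith
  -- Hölder's inequality with respect to the measure `w ^ (-s - 1) dμ`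
  have hbound : A ≤ I * (A ^ (1 / (s / (s - 1))) * ((ENNReal.ofReal s)⁻¹) ^ (1 / s)) := by
    calc A = ∫⁻ x, (w x ^ (-s - 1) * T x ^ (s - 1)) * T x ∂μ := by
          simp_rw [hA, hsplit, mul_assoc]
      _ ≤ _ := by
          refine hint _ _ (by fun_prop) fun y hy => ?_
          have hsub : ∀ x, w y < w x → w x ≠ 0 := fun x hx => (zero_le.trans_lt hx).ne'
          calc ∫⁻ x in {x | w y < w x}, w x ^ (-s - 1) * T x ^ (s - 1) ∂μ
              = ∫⁻ x in {x | w y < w x}, ((fun x => w x ^ ((-s - 1) * (1 / (s / (s - 1)))) *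
                  T x ^ (s - 1)) * fun x => w x ^ ((-s - 1) * (1 / s))) x ∂μ := by
                refine setLIntegral_congr_fun (measurableSet_lt measurable_const hw) fun x hx => ?_
                have : -s - 1 = (-s - 1) * (1 / (s / (s - 1))) + (-s - 1) * (1 / s) := by
                  field_simp; ring
                dsimp only [Pi.mul_apply]
                conv_lhs => rw [this]
                rw [ENNReal.rpow_add _ _ (hsub x hx) (hwt x)]
                ring
            _ ≤ _ := ENNReal.lintegral_mul_le_Lp_mul_Lq _ hconj
                  (Measurable.aemeasurable (by fun_prop)) (Measurable.aemeasurable (by fun_prop))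
            _ ≤ A ^ (1 / (s / (s - 1))) * (w y ^ (-s) * (ENNReal.ofReal s)⁻¹) ^ (1 / s) := by
                gcongr
                · refine (setLIntegral_le_lintegral _ _).trans (lintegral_mono fun x => ?_)
                  rw [ENNReal.mul_rpow_of_nonneg _ _ (by have := hconj.pos; exact this.le),
                    ← ENNReal.rpow_mul, ← ENNReal.rpow_mul]
                  apply le_of_eq
                  congr 2 <;> field_simp
                · refine le_trans (le_of_eq ?_) (htail s hs y hy)
                  refine lintegral_congr fun x => ?_
                  rw [← ENNReal.rpow_mul]
                  congr 1; field_simp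
            _ = _ := by
                rw [ENNReal.mul_rpow_of_nonneg _ _ (by positivity), ← ENNReal.rpow_mul]
                have : -s * (1 / s) = -1 := by field_simp
                rw [this, ENNReal.rpow_neg_one]
                ring
  have hB0 : A ^ (1 / (s / (s - 1))) ≠ 0 := by
    simp [ENNReal.rpow_eq_zero_iff, hA0, hAt]
  have hBt : A ^ (1 / (s / (s - 1))) ≠ ⊤ := by
    simp [ENNReal.rpow_eq_top_iff, hA0, hAt]
  have hroot : A ^ (1 / s) ≤ I * ((ENNReal.ofReal s)⁻¹) ^ (1 / s) := by
    rw [← ENNReal.mul_le_mul_iff_right hB0 hBt, ← ENNReal.rpow_add _ _ hA0 hAt]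
    have : 1 / (s / (s - 1)) + 1 / s = 1 := by field_simp; ring
    rw [this, ENNReal.rpow_one]
    exact hbound.trans (le_of_eq (by ring))
  have := ENNReal.rpow_le_rpow hroot hs0.le
  rw [ENNReal.mul_rpow_of_nonneg _ _ hs0.le, ← ENNReal.rpow_mul, ← ENNReal.rpow_mul,
    one_div_mul_cancel hs0.ne', ENNReal.rpow_one, ENNReal.rpow_one] at this
  rwa [mul_comm]

/-! ### Jensen's inequality for geometric means -/

/-- The geometric mean `exp ((a - b) / V)` of a function whose logarithm has a positive part of
integral `a` and a negative part of integral `b`, over a set of measure `V`. The value is `∞` as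
soon as `a = ∞`. -/
noncomputable def expMean (a b V : ℝ≥0∞) : ℝ≥0∞ :=
  open scoped Classical in
  if a = ⊤ then ⊤ else if b = ⊤ then 0
  else ENNReal.ofReal (Real.exp ((a.toReal - b.toReal) / V.toReal))

theorem expMean_eq {a b V : ℝ≥0∞} (h0 : V ≠ 0) (ht : V ≠ ⊤) :
    EReal.exp ((if a = ⊤ then ⊤ else (a : EReal) - (b : EReal)) / (V : EReal)) =
      expMean a b V := by
  have hV0 : (0 : EReal) < V := by exact_mod_cast pos_iff_ne_zero.2 h0
  have hVt : (V : EReal) ≠ ⊤ := by simpa using ht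
  unfold expMean
  split_ifs with ha hb
  · rw [EReal.top_div_of_pos_ne_top hV0 hVt, EReal.exp_top]
  · lift a to ℝ≥0 using ha
    rw [hb, EReal.coe_ennreal_top, EReal.sub_top, EReal.bot_div_of_pos_ne_top hV0 hVt,
      EReal.exp_bot]
  · lift a to ℝ≥0 using ha
    lift b to ℝ≥0 using hb
    lift V to ℝ≥0 using ht
    simp only [ENNReal.coe_toReal]
    rw [← EReal.exp_coe]
    congr 1

theorem measurable_expMean {α : Type*} [MeasurableSpace α] {a b V : α → ℝ≥0∞}
    (ha : Measurable a) (hb : Measurable b) (hV : Measurable V) :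
    Measurable fun x => expMean (a x) (b x) (V x) := by
  unfold expMean
  refine Measurable.ite (ha (measurableSet_singleton _)) measurable_const ?_
  refine Measurable.ite (hb (measurableSet_singleton _)) measurable_const ?_
  fun_prop

/-- Jensen's inequality for a geometric mean of `exp l`, where `p l = log H + k + ℓ`, the mean
value of `H` is at most `c` and that of `ℓ` is at most one. The functions `l` and `k` are not
assumed integrable; only the positive part of `k` is. -/
theorem expMean_rpow_le {α : Type*} [MeasurableSpace α] {μ : Measure α} [IsFiniteMeasure μ]
    (hμ : μ ≠ 0) {p c : ℝ} (hp : 0 < p) (hc : 0 < c) {l k ℓ H : α → ℝ} (hl : Measurable l)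
    (hk : Measurable k) (hH : Measurable H) (hℓ : Measurable ℓ)
    (hℓ0 : ∀ᵐ x ∂μ, 0 ≤ ℓ x) (hH0 : ∀ᵐ x ∂μ, 0 < H x)
    (hid : ∀ᵐ x ∂μ, p * l x = Real.log (H x) + k x + ℓ x)
    (hHint : ∫⁻ x, ENNReal.ofReal (H x) ∂μ ≤ ENNReal.ofReal c * μ Set.univ)
    (hℓint : ∫⁻ x, ENNReal.ofReal (ℓ x) ∂μ ≤ μ Set.univ)
    (hkint : ∫⁻ x, ENNReal.ofReal (k x) ∂μ ≠ ⊤) :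
    expMean (∫⁻ x, ENNReal.ofReal (l x) ∂μ) (∫⁻ x, ENNReal.ofReal (-l x) ∂μ) (μ Set.univ) ^ p ≤
      expMean (∫⁻ x, ENNReal.ofReal (k x) ∂μ) (∫⁻ x, ENNReal.ofReal (-k x) ∂μ) (μ Set.univ) *
        ENNReal.ofReal (Real.exp 1 * c) := by
  set V := μ Set.univ with hV
  have hV0 : V ≠ 0 := by simpa [hV] using hμ
  have hVt : V ≠ ⊤ := measure_ne_top _ _
  set a := ∫⁻ x, ENNReal.ofReal (l x) ∂μ
  set b := ∫⁻ x, ENNReal.ofReal (-l x) ∂μ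
  set a' := ∫⁻ x, ENNReal.ofReal (k x) ∂μ
  set b' := ∫⁻ x, ENNReal.ofReal (-k x) ∂μ
  have hconst : ∀ r : ℝ, ∫⁻ _, ENNReal.ofReal r ∂μ = ENNReal.ofReal r * V := fun r => by
    rw [lintegral_const]
  have hHint' : ∫⁻ x, ENNReal.ofReal (H x / c) ∂μ ≤ V := by
    simp_rw [div_eq_mul_inv, ENNReal.ofReal_mul' (inv_nonneg.2 hc.le)]
    rw [lintegral_mul_const _ (by fun_prop), ENNReal.ofReal_inv_of_pos hc]
    refine (mul_le_mul_left hHint _).trans (le_of_eq ?_)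
    rw [mul_right_comm, ENNReal.mul_inv_cancel (by simpa using hc) (by simp), one_mul]
  -- The tangent line to the logarithm at `c`.
  have htan : ∀ᵐ x ∂μ, p * l x ≤ H x / c - 1 + Real.log c + k x + ℓ x := by
    filter_upwards [hid, hH0] with x h1 h2
    have := Real.log_le_sub_one_of_pos (div_pos h2 hc)
    rw [Real.log_div h2.ne' hc.ne'] at this
    linarith
  -- The integrated inequality, with every negative term moved to the other side.
  have hmain : ENNReal.ofReal p * a + b' + V + ENNReal.ofReal (-Real.log c) * V ≤
      ENNReal.ofReal p * b + a' + V + V + ENNReal.ofReal (Real.log c) * V := by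
    calc ENNReal.ofReal p * a + b' + V + ENNReal.ofReal (-Real.log c) * V
        = ∫⁻ x, (ENNReal.ofReal p * ENNReal.ofReal (l x) + ENNReal.ofReal (-k x) +
            ENNReal.ofReal 1 + ENNReal.ofReal (-Real.log c)) ∂μ := by
          rw [lintegral_add_right _ (by fun_prop), lintegral_add_right _ (by fun_prop),
            lintegral_add_right _ (by fun_prop), lintegral_const_mul _ (by fun_prop),
            hconst, hconst, ENNReal.ofReal_one, one_mul]
      _ ≤ ∫⁻ x, (ENNReal.ofReal p * ENNReal.ofReal (-l x) + ENNReal.ofReal (k x) +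
            ENNReal.ofReal (H x / c) + ENNReal.ofReal (ℓ x) +
            ENNReal.ofReal (Real.log c)) ∂μ := by
          refine lintegral_mono_ae ?_
          filter_upwards [htan, hℓ0, hH0] with x h1 h2 h3
          have h4 : 0 ≤ H x / c := by positivity
          have e : ∀ t : ℝ, ENNReal.ofReal t = ENNReal.ofReal (max t 0) := fun t => by
            rcases le_total t 0 with h | h <;> simp [h, ENNReal.ofReal_of_nonpos]
          rw [e (l x), e (-l x), e (k x), e (-k x), e (Real.log c), e (-Real.log c),
            ← ENNReal.ofReal_mul hp.le, ← ENNReal.ofReal_mul hp.le,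
            ← ENNReal.ofReal_add (by positivity) (by positivity),
            ← ENNReal.ofReal_add (by positivity) (by positivity),
            ← ENNReal.ofReal_add (by positivity) (by positivity),
            ← ENNReal.ofReal_add (by positivity) (by positivity),
            ← ENNReal.ofReal_add (by positivity) (by positivity),
            ← ENNReal.ofReal_add (by positivity) (by positivity),
            ← ENNReal.ofReal_add (by positivity) (by positivity)]
          refine ENNReal.ofReal_le_ofReal ?_
          have m : ∀ t : ℝ, max t 0 - max (-t) 0 = t := fun t => by
            rcases le_total t 0 with h | h <;> simp [h]
          have m1 := m (k x)
          have m2 := m (Real.log c)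
          have m3 : p * max (l x) 0 - p * max (-l x) 0 = p * l x := by rw [← mul_sub, m]
          linarith
      _ = ENNReal.ofReal p * b + a' + (∫⁻ x, ENNReal.ofReal (H x / c) ∂μ) +
            (∫⁻ x, ENNReal.ofReal (ℓ x) ∂μ) + ENNReal.ofReal (Real.log c) * V := by
          rw [lintegral_add_right _ (by fun_prop), lintegral_add_right _ (by fun_prop),
            lintegral_add_right _ (by fun_prop), lintegral_add_right _ (by fun_prop),
            lintegral_const_mul _ (by fun_prop), hconst]
      _ ≤ _ := by gcongr
  -- The positive part of `l` has finite integral, so the first branch of `expMean` is excluded.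
  have hfin : ENNReal.ofReal p * a ≤ a' + V + V + ENNReal.ofReal (Real.log c) * V := by
    calc ENNReal.ofReal p * a = ∫⁻ x, ENNReal.ofReal p * ENNReal.ofReal (l x) ∂μ :=
          (lintegral_const_mul _ (by fun_prop)).symm
      _ ≤ ∫⁻ x, (ENNReal.ofReal (k x) + ENNReal.ofReal (H x / c) + ENNReal.ofReal (ℓ x) +
            ENNReal.ofReal (Real.log c)) ∂μ := by
          refine lintegral_mono_ae ?_
          filter_upwards [htan] with x h1
          rw [← ENNReal.ofReal_mul hp.le]
          refine (ENNReal.ofReal_le_ofReal (q := k x + H x / c + ℓ x + Real.log c)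
            (by linarith)).trans ?_
          refine ENNReal.ofReal_add_le.trans ?_
          gcongr
          refine ENNReal.ofReal_add_le.trans ?_
          gcongr
          exact ENNReal.ofReal_add_le
      _ = a' + (∫⁻ x, ENNReal.ofReal (H x / c) ∂μ) +
            (∫⁻ x, ENNReal.ofReal (ℓ x) ∂μ) + ENNReal.ofReal (Real.log c) * V := by
          rw [lintegral_add_right _ (by fun_prop), lintegral_add_right _ (by fun_prop),
            lintegral_add_right _ (by fun_prop), hconst]
      _ ≤ _ := by gcongr
  have hp0 : ENNReal.ofReal p ≠ 0 := by simpa using hp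
  have hcV : ∀ r, ENNReal.ofReal r * V ≠ ⊤ := fun r => ENNReal.mul_ne_top (by simp) hVt
  have hat : a ≠ ⊤ := by
    intro h
    rw [h, ENNReal.mul_top hp0, top_le_iff] at hfin
    simp [ENNReal.add_eq_top, hkint, hVt, hcV] at hfin
  by_cases hb : b = ⊤
  · simp [expMean, hat, hb, hp]
  have hpb : ENNReal.ofReal p * b ≠ ⊤ := ENNReal.mul_ne_top (by simp) hb
  have hpa : ENNReal.ofReal p * a ≠ ⊤ := ENNReal.mul_ne_top (by simp) hat
  have hR : ENNReal.ofReal p * b + a' + V + V + ENNReal.ofReal (Real.log c) * V ≠ ⊤ := by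
    simp only [ne_eq, ENNReal.add_eq_top, not_or]
    exact ⟨⟨⟨⟨hpb, hkint⟩, hVt⟩, hVt⟩, hcV _⟩
  have hbt' : b' ≠ ⊤ := by
    intro h
    rw [h] at hmain
    simp only [add_top, top_add, top_le_iff] at hmain
    exact hR hmain
  unfold expMean
  rw [if_neg hat, if_neg hb, if_neg hkint, if_neg hbt', ENNReal.ofReal_rpow_of_pos (Real.exp_pos _),
    ← ENNReal.ofReal_mul (Real.exp_pos _).le]
  refine ENNReal.ofReal_le_ofReal ?_
  have hVr : 0 < V.toReal := ENNReal.toReal_pos hV0 hVt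
  have hreal := ENNReal.toReal_mono hR hmain
  rw [ENNReal.toReal_add (by simp [ENNReal.add_eq_top, hpa, hbt', hVt]) (hcV _),
    ENNReal.toReal_add (by simp [ENNReal.add_eq_top, hpa, hbt']) hVt,
    ENNReal.toReal_add hpa hbt',
    ENNReal.toReal_add (by simp only [ne_eq, ENNReal.add_eq_top, not_or]; tauto) (hcV _),
    ENNReal.toReal_add (by simp only [ne_eq, ENNReal.add_eq_top, not_or]; tauto) hVt,
    ENNReal.toReal_add (by simp only [ne_eq, ENNReal.add_eq_top, not_or]; tauto) hVt,
    ENNReal.toReal_add hpb hkint] at hreal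
  simp only [ENNReal.toReal_mul, ENNReal.toReal_ofReal hp.le] at hreal
  have hlog : (ENNReal.ofReal (Real.log c)).toReal - (ENNReal.ofReal (-Real.log c)).toReal =
      Real.log c := by
    rcases le_total (Real.log c) 0 with h | h
    · rw [ENNReal.ofReal_of_nonpos h, ENNReal.toReal_ofReal (by linarith)]; simp
    · rw [ENNReal.ofReal_of_nonpos (by linarith : -Real.log c ≤ 0), ENNReal.toReal_ofReal h]; simp
  rw [← Real.exp_mul, ← mul_assoc, ← Real.exp_add, ← Real.exp_log hc, ← Real.exp_add,
    Real.exp_le_exp, div_mul_eq_mul_div, div_le_iff₀ hVr]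
  have : ((a'.toReal - b'.toReal) / V.toReal + 1 + Real.log c) * V.toReal =
      a'.toReal - b'.toReal + V.toReal + Real.log c * V.toReal := by field_simp
  rw [this, ← hlog]
  nlinarith

/-! ### Positive and negative parts of extended logarithms -/

theorem toENNReal_log_coe {t : ℝ≥0} (ht : t ≠ 0) :
    (ENNReal.log (t : ℝ≥0∞)).toENNReal = ENNReal.ofReal (Real.log t) := by
  rw [ENNReal.log_of_nnreal ht, EReal.real_coe_toENNReal]

theorem toENNReal_neg_log_coe {t : ℝ≥0} (ht : t ≠ 0) :
    (-ENNReal.log (t : ℝ≥0∞)).toENNReal = ENNReal.ofReal (-Real.log t) := by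
  rw [ENNReal.log_of_nnreal ht, ← EReal.coe_neg, EReal.real_coe_toENNReal]

theorem toENNReal_log_one_div_coe {t : ℝ≥0} (ht : t ≠ 0) :
    (ENNReal.log (1 / (t : ℝ≥0∞))).toENNReal = ENNReal.ofReal (-Real.log t) := by
  rw [one_div, ENNReal.log_inv, toENNReal_neg_log_coe ht]

theorem toENNReal_neg_log_one_div_coe {t : ℝ≥0} (ht : t ≠ 0) :
    (-ENNReal.log (1 / (t : ℝ≥0∞))).toENNReal = ENNReal.ofReal (Real.log t) := by
  rw [one_div, ENNReal.log_inv, neg_neg, toENNReal_log_coe ht]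

theorem measurable_toENNReal_log {α : Type*} [MeasurableSpace α] {h : α → ℝ≥0∞}
    (hh : Measurable h) : Measurable fun x => (ENNReal.log (h x)).toENNReal := by
  fun_prop

/-! ### Quasi-balls and polar coordinates -/

namespace HomogeneousGroup.QuasiNorm

variable {N : ℕ} [Group (EuclideanSpace ℝ (Fin N))]
  [LieGroup 𝓘(ℝ, EuclideanSpace ℝ (Fin N)) ∞ (EuclideanSpace ℝ (Fin N))]
  {G : HomogeneousGroup N}

theorem measurable_toFun (ρ : G.QuasiNorm) : Measurable ρ.toFun :=
  ρ.continuous_toFun.measurable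

theorem toFun_pos (ρ : G.QuasiNorm) {x : EuclideanSpace ℝ (Fin N)} (hx : x ≠ 0) :
    0 < ρ.toFun x :=
  (ρ.nonneg x).lt_of_ne fun h => hx ((ρ.eq_zero_iff x).1 h.symm)

theorem ae_toFun_pos (hN : 0 < N) (ρ : G.QuasiNorm) : ∀ᵐ x, 0 < ρ.toFun x := by
  have : Nonempty (Fin N) := ⟨⟨0, hN⟩⟩
  have h0 : ∀ᵐ w : EuclideanSpace ℝ (Fin N), w ≠ 0 := by
    rw [ae_iff]
    simp
  exact h0.mono fun x hx => ρ.toFun_pos hx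

theorem measurableSet_ball (ρ : G.QuasiNorm) (r : ℝ) : MeasurableSet (ρ.ball r) :=
  measurableSet_lt ρ.measurable_toFun measurable_const

theorem ball_mono (ρ : G.QuasiNorm) {r t : ℝ} (h : r ≤ t) : ρ.ball r ⊆ ρ.ball t :=
  fun _ hy => lt_of_lt_of_le hy h

/-- Compactness and homogeneity compare the quasi-norm with `max_i |x_i| ^ (1 / ν_i)`. -/
theorem isBounded_ball_one (hN : 0 < N) (ρ : G.QuasiNorm) :
    Bornology.IsBounded (ρ.ball 1) := by
  have : Nonempty (Fin N) := ⟨⟨0, hN⟩⟩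
  -- `K` is the boundary of the cube `[-1, 1] ^ N`, on which the quasi-norm has a positive minimum.
  let K : Set (EuclideanSpace ℝ (Fin N)) := {x | (∀ i, |x i| ≤ 1) ∧ ∃ i, |x i| = 1}
  have hKc : IsCompact K := by
    refine Metric.isCompact_of_isClosed_isBounded ?_ ?_
    · have : K = (⋂ i, {x | |x i| ≤ 1}) ∩ ⋃ i, {x | |x i| = 1} := by
        ext x; simp [K]
      rw [this]
      refine (isClosed_iInter fun i => isClosed_le (by fun_prop) (by fun_prop)).inter
        (isClosed_iUnion_of_finite fun i => isClosed_eq (by fun_prop) (by fun_prop))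
    · refine (Metric.isBounded_closedBall (x := 0) (r := √(N : ℝ))).subset fun x hx => ?_
      rw [mem_closedBall_zero_iff, EuclideanSpace.norm_eq]
      refine Real.sqrt_le_sqrt ?_
      calc ∑ i, ‖x i‖ ^ 2 ≤ ∑ _i : Fin N, (1 : ℝ) :=
            Finset.sum_le_sum fun i _ => pow_le_one₀ (norm_nonneg _) (hx.1 i)
        _ = N := by simp
  have hKne : K.Nonempty :=
    ⟨WithLp.toLp 2 fun _ => 1, fun i => by simp, ⟨0, hN⟩, by simp⟩
  obtain ⟨x₀, hx₀, hmin⟩ := hKc.exists_isMinOn hKne ρ.continuous_toFun.continuousOn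
  have hm : 0 < ρ.toFun x₀ := by
    refine ρ.toFun_pos ?_
    rintro rfl
    obtain ⟨i, hi⟩ := hx₀.2
    simp at hi
  set m := ρ.toFun x₀
  -- A nonzero point of the unit ball is the dilation of a point of `K` by some `t ≤ 1 / m`.
  have hcoord : ∀ x ∈ ρ.ball 1, ∀ i, |x i| ≤ (1 / m) ^ G.expo i := by
    intro x hx
    rcases eq_or_ne x 0 with rfl | hx0
    · intro i
      simp only [PiLp.zero_apply, abs_zero]
      positivity
    obtain ⟨j, hj⟩ := Finite.exists_max fun i => |x i| ^ (1 / G.expo i)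
    set t := |x j| ^ (1 / G.expo j) with ht
    have hxt : ∀ i, |x i| ≤ t ^ G.expo i := fun i => by
      have := Real.rpow_le_rpow (by positivity) (hj i) (G.expo_pos i).le
      rwa [← Real.rpow_mul (abs_nonneg _), one_div_mul_cancel (G.expo_pos i).ne',
        Real.rpow_one] at this
    have ht0 : 0 < t := by
      have ht0 : 0 ≤ t := by positivity
      refine ht0.lt_of_ne fun h => hx0 ?_
      ext i
      have := hxt i
      rw [← h, Real.zero_rpow (G.expo_pos i).ne'] at this
      simpa using this
    have hy : G.dil t⁻¹ x ∈ K := by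
      have habs : ∀ i, |(G.dil t⁻¹ x) i| = |x i| / t ^ G.expo i := fun i => by
        have : 0 < t ^ G.expo i := by positivity
        simp only [HomogeneousGroup.dil, abs_mul, Real.inv_rpow ht0.le, abs_inv, abs_of_pos this]
        field_simp
      refine ⟨fun i => ?_, j, ?_⟩
      · rw [habs, div_le_one (by positivity)]
        exact hxt i
      · rw [habs, ht, ← Real.rpow_mul (abs_nonneg _), one_div_mul_cancel (G.expo_pos j).ne',
          Real.rpow_one, div_self]
        intro h
        rw [ht, h, Real.zero_rpow (by have := G.expo_pos j; positivity)] at ht0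
        exact ht0.false
    have h1 : m ≤ t⁻¹ * ρ.toFun x := by
      rw [← ρ.map_dil _ _ (inv_pos.2 ht0)]
      exact hmin hy
    have h2 : t ≤ 1 / m := by
      have h3 : t⁻¹ * ρ.toFun x ≤ t⁻¹ := by
        have : ρ.toFun x < 1 := hx
        exact mul_le_of_le_one_right (by positivity) this.le
      rw [le_div_iff₀ hm]
      have := mul_le_mul_of_nonneg_left (h1.trans h3) ht0.le
      rwa [mul_inv_cancel₀ ht0.ne'] at this
    exact fun i => (hxt i).trans (Real.rpow_le_rpow ht0.le h2 (G.expo_pos i).le)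
  refine (Metric.isBounded_closedBall (x := 0)
    (r := √(∑ i, ((1 / m) ^ G.expo i) ^ 2))).subset fun x hx => ?_
  rw [mem_closedBall_zero_iff, EuclideanSpace.norm_eq]
  refine Real.sqrt_le_sqrt (Finset.sum_le_sum fun i _ => ?_)
  exact pow_le_pow_left₀ (norm_nonneg _) (hcoord x hx i) 2

theorem volume_ball_one_lt_top (hN : 0 < N) (ρ : G.QuasiNorm) : volume (ρ.ball 1) < ⊤ :=
  (ρ.isBounded_ball_one hN).measure_lt_top

theorem volume_ball_one_pos (ρ : G.QuasiNorm) : 0 < volume (ρ.ball 1) := by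
  refine IsOpen.measure_pos _ (isOpen_lt ρ.continuous_toFun continuous_const) ⟨0, ?_⟩
  change ρ.toFun 0 < 1
  rw [(ρ.eq_zero_iff 0).2 rfl]
  exact one_pos

theorem volume_ball (ρ : G.QuasiNorm) {r : ℝ} (hr : 0 < r) :
    volume (ρ.ball r) = ENNReal.ofReal (r ^ G.homDim) * volume (ρ.ball 1) := by
  have h := lintegral_dil G hr (F := (ρ.ball r).indicator 1)
    (measurable_one.indicator (ρ.measurableSet_ball r))
  have e : ∀ x, (ρ.ball r).indicator (1 : EuclideanSpace ℝ (Fin N) → ℝ≥0∞) (G.dil r x) =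
      (ρ.ball 1).indicator 1 x := fun x => by
    have : G.dil r x ∈ ρ.ball r ↔ x ∈ ρ.ball 1 := by
      change ρ.toFun (G.dil r x) < r ↔ ρ.toFun x < 1
      rw [ρ.map_dil r x hr]
      constructor <;> intro h <;> nlinarith
    classical simp only [Set.indicator_apply, this, Pi.one_apply]
  simp_rw [e] at h
  rw [lintegral_indicator_one (ρ.measurableSet_ball _),
    lintegral_indicator_one (ρ.measurableSet_ball _)] at h
  rw [h, ← mul_assoc, ← ENNReal.ofReal_mul (by positivity), ← Real.rpow_add hr]
  simp

theorem volume_ball_pos (ρ : G.QuasiNorm) {r : ℝ} (hr : 0 < r) : 0 < volume (ρ.ball r) := by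
  rw [ρ.volume_ball hr]
  exact ENNReal.mul_pos (by simpa using Real.rpow_pos_of_pos hr _) ρ.volume_ball_one_pos.ne'

theorem volume_ball_of_nonpos (ρ : G.QuasiNorm) {r : ℝ} (hr : r ≤ 0) :
    volume (ρ.ball r) = 0 := by
  have : ρ.ball r = ∅ :=
    Set.eq_empty_of_forall_notMem fun x hx => (ρ.nonneg x).not_gt (lt_of_lt_of_le hx hr)
  rw [this, measure_empty]

theorem volume_ball_ne_top (hN : 0 < N) (ρ : G.QuasiNorm) (r : ℝ) : volume (ρ.ball r) ≠ ⊤ := by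
  rcases le_or_gt r 0 with hr | hr
  · simp [ρ.volume_ball_of_nonpos hr]
  · rw [ρ.volume_ball hr]
    exact ENNReal.mul_ne_top ENNReal.ofReal_ne_top (ρ.volume_ball_one_lt_top hN).ne

theorem volume_ball_lt_iff (hN : 0 < N) (ρ : G.QuasiNorm) (x y : EuclideanSpace ℝ (Fin N)) :
    volume (ρ.ball (ρ.toFun y)) < volume (ρ.ball (ρ.toFun x)) ↔ ρ.toFun y < ρ.toFun x := by
  refine ⟨fun h => ?_, fun h => ?_⟩
  · by_contra! hle
    exact h.not_ge (measure_mono (ρ.ball_mono hle))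
  · have hx : 0 < ρ.toFun x := (ρ.nonneg y).trans_lt h
    rcases (ρ.nonneg y).eq_or_lt with hy | hy
    · rw [← hy, ρ.volume_ball_of_nonpos le_rfl]
      exact ρ.volume_ball_pos hx
    · rw [ρ.volume_ball hx, ρ.volume_ball hy]
      refine ENNReal.mul_lt_mul_left ρ.volume_ball_one_pos.ne'
        (ρ.volume_ball_one_lt_top hN).ne ?_
      have := homDim_pos hN G
      exact (ENNReal.ofReal_lt_ofReal_iff (by positivity)).2 (Real.rpow_lt_rpow hy.le h this)

theorem measurable_volume_ball (ρ : G.QuasiNorm) :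
    Measurable fun x => volume (ρ.ball (ρ.toFun x)) :=
  (Monotone.measurable fun _ _ h => measure_mono (ρ.ball_mono h) :
    Measurable fun r => volume (ρ.ball r)).comp ρ.measurable_toFun

theorem sphereMeasure_sphere (hN : 0 < N) (ρ : G.QuasiNorm) :
    ρ.sphereMeasure ρ.sphere = ENNReal.ofReal G.homDim * volume (ρ.ball 1) := by
  have h := ρ.lintegral_sphereMeasure (F := fun _ => 1) measurable_const
  simp only [lintegral_const, one_mul, Measure.restrict_apply MeasurableSet.univ,
    Set.univ_inter] at h
  rw [h]
  congr 1
  refine measure_congr ?_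
  filter_upwards [ρ.ae_toFun_pos hN] with x hx
  exact propext (and_iff_right hx)

theorem sphereMeasure_sphere_ne_zero (hN : 0 < N) (ρ : G.QuasiNorm) :
    ρ.sphereMeasure ρ.sphere ≠ 0 := by
  rw [ρ.sphereMeasure_sphere hN]
  exact mul_ne_zero (by simpa using homDim_pos hN G) ρ.volume_ball_one_pos.ne'

theorem sphereMeasure_sphere_ne_top (hN : 0 < N) (ρ : G.QuasiNorm) :
    ρ.sphereMeasure ρ.sphere ≠ ⊤ := by
  rw [ρ.sphereMeasure_sphere hN]
  exact ENNReal.mul_ne_top ENNReal.ofReal_ne_top (ρ.volume_ball_one_lt_top hN).ne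

theorem toFun_dil_of_mem_sphere (ρ : G.QuasiNorm) {r : ℝ} (hr : 0 < r)
    {y : EuclideanSpace ℝ (Fin N)} (hy : y ∈ ρ.sphere) : ρ.toFun (G.dil r y) = r := by
  have : ρ.toFun y = 1 := hy
  rw [ρ.map_dil r y hr, this, mul_one]

theorem measurableSet_sphere (ρ : G.QuasiNorm) : MeasurableSet ρ.sphere :=
  measurableSet_eq_fun ρ.measurable_toFun measurable_const

/-- A radial function integrates against `u` as it does against the spherical average of `u`. -/
theorem lintegral_radial_mul (hN : 0 < N) (ρ : G.QuasiNorm) {Φ : ℝ → ℝ≥0∞} (hΦ : Measurable Φ)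
    {u : EuclideanSpace ℝ (Fin N) → ℝ≥0} (hu : Measurable u) :
    ∫⁻ x, Φ (ρ.toFun x) * (u x : ℝ≥0∞) =
      ∫⁻ x, Φ (ρ.toFun x) * ρ.sphericalAverage u x := by
  have hσ0 := ρ.sphereMeasure_sphere_ne_zero hN
  have hσt := ρ.sphereMeasure_sphere_ne_top hN
  have hum : Measurable fun r => ∫⁻ y in ρ.sphere, (u (G.dil r y) : ℝ≥0∞) ∂ρ.sphereMeasure := by
    have : IsFiniteMeasure (ρ.sphereMeasure.restrict ρ.sphere) := ⟨by simpa using hσt.lt_top⟩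
    exact Measurable.lintegral_prod_right'
      (f := fun z : ℝ × EuclideanSpace ℝ (Fin N) => (u (G.dil z.1 z.2) : ℝ≥0∞))
      (hu.coe_nnreal_ennreal.comp (measurable_dil G))
  have hdilr : ∀ r, Measurable (G.dil r) := fun r =>
    (measurable_dil G).comp (measurable_const.prodMk measurable_id)
  have hm1 : Measurable fun x => Φ (ρ.toFun x) * (u x : ℝ≥0∞) :=
    (hΦ.comp ρ.measurable_toFun).mul hu.coe_nnreal_ennreal
  have hm2 : Measurable fun x => Φ (ρ.toFun x) * ρ.sphericalAverage u x :=
    (hΦ.comp ρ.measurable_toFun).mul ((hum.comp ρ.measurable_toFun).const_mul _)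
  rw [lintegral_polar hN ρ hm1, lintegral_polar hN ρ hm2]
  refine setLIntegral_congr_fun measurableSet_Ioi fun r hr => ?_
  have hr0 : (0 : ℝ) < r := hr
  have e1 : ∫⁻ y in ρ.sphere, Φ (ρ.toFun (G.dil r y)) * (u (G.dil r y) : ℝ≥0∞) *
      ENNReal.ofReal (r ^ (G.homDim - 1)) ∂ρ.sphereMeasure =
      Φ r * ENNReal.ofReal (r ^ (G.homDim - 1)) *
        ∫⁻ y in ρ.sphere, (u (G.dil r y) : ℝ≥0∞) ∂ρ.sphereMeasure := by
    have hur : Measurable fun y => (u (G.dil r y) : ℝ≥0∞) :=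
      (hu.comp (hdilr r)).coe_nnreal_ennreal
    rw [← lintegral_const_mul _ hur]
    refine setLIntegral_congr_fun ρ.measurableSet_sphere fun y hy => ?_
    rw [ρ.toFun_dil_of_mem_sphere hr0 hy]
    ring
  have e2 : ∫⁻ y in ρ.sphere, Φ (ρ.toFun (G.dil r y)) * ρ.sphericalAverage u (G.dil r y) *
      ENNReal.ofReal (r ^ (G.homDim - 1)) ∂ρ.sphereMeasure =
      ∫⁻ _ in ρ.sphere, Φ r * ((ρ.sphereMeasure ρ.sphere)⁻¹ *
        ∫⁻ y in ρ.sphere, (u (G.dil r y) : ℝ≥0∞) ∂ρ.sphereMeasure) *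
          ENNReal.ofReal (r ^ (G.homDim - 1)) ∂ρ.sphereMeasure := by
    refine setLIntegral_congr_fun ρ.measurableSet_sphere fun y hy => ?_
    simp only [sphericalAverage]
    rw [ρ.toFun_dil_of_mem_sphere hr0 hy]
  refine e1.trans (Eq.trans ?_ e2.symm)
  rw [lintegral_const, Measure.restrict_apply MeasurableSet.univ, Set.univ_inter]
  calc _ = (ρ.sphereMeasure ρ.sphere * (ρ.sphereMeasure ρ.sphere)⁻¹) *
        (Φ r * ENNReal.ofReal (r ^ (G.homDim - 1)) *
        ∫⁻ y in ρ.sphere, (u (G.dil r y) : ℝ≥0∞) ∂ρ.sphereMeasure) := by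
          rw [ENNReal.mul_inv_cancel hσ0 hσt, one_mul]
    _ = _ := by ring

/-- In the variable `|B(0,|x|)|`, Lebesgue measure is one-dimensional: this is
`∫_a^∞ τ ^ (-t - 1) dτ = a ^ (-t) / t` with `a = |B_r|`. -/
theorem lintegral_volume_ball_rpow_tail (hN : 0 < N) (ρ : G.QuasiNorm) {t r : ℝ} (ht : 0 < t)
    (hr : 0 < r) :
    ∫⁻ x in {x | r < ρ.toFun x}, volume (ρ.ball (ρ.toFun x)) ^ (-t - 1) =
      volume (ρ.ball r) ^ (-t) * (ENNReal.ofReal t)⁻¹ := by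
  have hQ := homDim_pos hN G
  set Q := G.homDim with hQd
  set b := volume (ρ.ball 1) with hb
  have hb0 : b ≠ 0 := ρ.volume_ball_one_pos.ne'
  have hbt : b ≠ ⊤ := (ρ.volume_ball_one_lt_top hN).ne
  have hS : MeasurableSet {x | r < ρ.toFun x} :=
    measurableSet_lt measurable_const ρ.measurable_toFun
  have hpow : ∀ (a : ℝ) {s : ℝ}, 0 < s → volume (ρ.ball s) ^ a =
      ENNReal.ofReal (s ^ (Q * a)) * b ^ a := fun a s hs => by
    rw [ρ.volume_ball hs, ENNReal.mul_rpow_of_ne_top (by simp) hbt,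
      ENNReal.ofReal_rpow_of_pos (by positivity), ← Real.rpow_mul hs.le]
  rw [← lintegral_indicator hS,
    lintegral_polar hN ρ ((ρ.measurable_volume_ball.pow_const _).indicator hS)]
  calc _ = ∫⁻ s in Set.Ioi (0 : ℝ), (Set.Ioi r).indicator (fun s =>
        ρ.sphereMeasure ρ.sphere * b ^ (-t - 1) * ENNReal.ofReal (s ^ (-(Q * t) - 1))) s := by
        refine setLIntegral_congr_fun measurableSet_Ioi fun s hs => ?_
        have hs0 : (0 : ℝ) < s := hs
        have e : ∀ y ∈ ρ.sphere, ({x | r < ρ.toFun x}.indicator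
            (fun x => volume (ρ.ball (ρ.toFun x)) ^ (-t - 1)) (G.dil s y)) *
              ENNReal.ofReal (s ^ (Q - 1)) = (Set.Ioi r).indicator (fun s =>
            b ^ (-t - 1) * ENNReal.ofReal (s ^ (-(Q * t) - 1))) s := fun y hy => by
          simp only [Set.indicator_apply, Set.mem_ofPred_eq, Set.mem_Ioi,
            ρ.toFun_dil_of_mem_sphere hs0 hy]
          split_ifs
          · rw [hpow _ hs0, mul_comm, ← mul_assoc, ← ENNReal.ofReal_mul (by positivity),
              ← Real.rpow_add hs0, mul_comm]
            ring_nf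
          · simp
        refine (setLIntegral_congr_fun ρ.measurableSet_sphere e).trans ?_
        rw [lintegral_const, Measure.restrict_apply MeasurableSet.univ, Set.univ_inter]
        simp only [Set.indicator_apply]
        split_ifs <;> ring
    _ = ∫⁻ s in Set.Ioi r,
          ρ.sphereMeasure ρ.sphere * b ^ (-t - 1) * ENNReal.ofReal (s ^ (-(Q * t) - 1)) := by
        rw [lintegral_indicator measurableSet_Ioi, Measure.restrict_restrict measurableSet_Ioi,
          Set.inter_eq_left.2 (Set.Ioi_subset_Ioi hr.le)]
    _ = _ := by
        rw [lintegral_const_mul _ (by fun_prop), lintegral_Ioi_neg_rpow (by positivity) hr,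
          ρ.sphereMeasure_sphere hN, hpow _ hr, ← ENNReal.ofReal_inv_of_pos ht,
          ← hQd, ← hb]
        have e1 : b ^ (-t) = b * b ^ (-t - 1) := by
          conv_rhs => rw [← ENNReal.rpow_one b, ← ENNReal.rpow_mul, ← ENNReal.rpow_add _ _ hb0 hbt]
          congr 1; ring
        have e2 : ENNReal.ofReal Q * ENNReal.ofReal (r ^ (-(Q * t)) / (Q * t)) =
            ENNReal.ofReal (r ^ (Q * -t)) * ENNReal.ofReal t⁻¹ := by
          rw [← ENNReal.ofReal_mul hQ.le, ← ENNReal.ofReal_mul (by positivity)]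
          congr 1
          rw [mul_neg]
          field_simp
        rw [e1]
        calc _ = (ENNReal.ofReal Q * ENNReal.ofReal (r ^ (-(Q * t)) / (Q * t))) *
              (b * b ^ (-t - 1)) := by ring
          _ = _ := by rw [e2]; ring

/-- The logarithm `log (|B_r| / |B_{|y|}|)` has mean value one over the ball `B_r`. -/
theorem lintegral_ball_log (hN : 0 < N) (ρ : G.QuasiNorm) {r : ℝ} (hr : 0 < r) :
    ∫⁻ y in ρ.ball r, ENNReal.ofReal (G.homDim * Real.log (r / ρ.toFun y)) =
      volume (ρ.ball r) := by
  have hQ := homDim_pos hN G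
  set Q := G.homDim with hQd
  -- `Q log (r / |y|)` is the integral of `Q / t` over `|y| < t ≤ r`, so Tonelli's theorem applies.
  let K : EuclideanSpace ℝ (Fin N) × ℝ → ℝ≥0∞ :=
    {z | ρ.toFun z.1 < z.2}.indicator fun z => ENNReal.ofReal (Q * z.2⁻¹)
  have hK : Measurable K := Measurable.indicator (by fun_prop)
    (measurableSet_lt (ρ.measurable_toFun.comp measurable_fst) measurable_snd)
  have hint : ∀ s, 0 < s → s ≤ r → ∫⁻ t in Set.Ioc s r, ENNReal.ofReal (Q * t⁻¹) =
      ENNReal.ofReal (Q * Real.log (r / s)) := fun s hs hsr => by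
    have hI : IntervalIntegrable (fun t : ℝ => Q * t⁻¹) volume s r :=
      (intervalIntegral.intervalIntegrable_inv (fun x hx => by
        rw [Set.uIcc_of_le hsr] at hx
        exact (hs.trans_le hx.1).ne') continuousOn_id).const_mul _
    rw [← ofReal_integral_eq_lintegral_ofReal
      ((intervalIntegrable_iff_integrableOn_Ioc_of_le hsr).1 hI),
      ← intervalIntegral.integral_of_le hsr, intervalIntegral.integral_const_mul,
      integral_inv_of_pos hs hr]
    filter_upwards [ae_restrict_mem measurableSet_Ioc] with t ht
    have : 0 < t := hs.trans ht.1
    positivity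
  calc _ = ∫⁻ y, ∫⁻ t in Set.Ioc 0 r, K (y, t) := by
        classical
        rw [← lintegral_indicator (ρ.measurableSet_ball r)]
        refine lintegral_congr_ae ?_
        filter_upwards [ρ.ae_toFun_pos hN] with y hy
        have e : (fun t => K (y, t)) =
            (Set.Ioi (ρ.toFun y)).indicator fun t => ENNReal.ofReal (Q * t⁻¹) := by
          ext t
          simp [K, Set.indicator_apply]
        rw [e, lintegral_indicator measurableSet_Ioi, Measure.restrict_restrict measurableSet_Ioi,
          Set.indicator_apply]
        split_ifs with h
        · rw [← hint _ hy (le_of_lt h)]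
          congr 2
          ext t
          simp only [Set.mem_inter_iff, Set.mem_Ioi, Set.mem_Ioc]
          exact ⟨fun h => ⟨h.1, hy.trans h.1, h.2⟩, fun h => ⟨h.1, h.2.2⟩⟩
        · have : Set.Ioi (ρ.toFun y) ∩ Set.Ioc 0 r = ∅ := by
            ext t
            simp only [Set.mem_inter_iff, Set.mem_Ioi, Set.mem_Ioc, Set.mem_empty_iff_false,
              iff_false]
            exact fun h' => h (lt_of_lt_of_le h'.1 h'.2.2)
          simp [this]
    _ = ∫⁻ t in Set.Ioc 0 r, ∫⁻ y, K (y, t) := lintegral_lintegral_swap hK.aemeasurable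
    _ = ∫⁻ t in Set.Ioc 0 r, ENNReal.ofReal (Q * t ^ (Q - 1)) * volume (ρ.ball 1) := by
        refine setLIntegral_congr_fun measurableSet_Ioc fun t ht => ?_
        have ht0 : 0 < t := ht.1
        have e : (fun y => K (y, t)) = (ρ.ball t).indicator fun _ => ENNReal.ofReal (Q * t⁻¹) := by
          ext y
          simp [K, Set.indicator_apply, ball]
        rw [e, lintegral_indicator_const (ρ.measurableSet_ball t), ρ.volume_ball ht0, ← mul_assoc,
          ← ENNReal.ofReal_mul (by positivity), Real.rpow_sub_one ht0.ne', ← hQd]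
        congr 2
        field_simp
    _ = _ := by
        have hI : IntervalIntegrable (fun t : ℝ => Q * t ^ (Q - 1)) volume 0 r :=
          (intervalIntegral.intervalIntegrable_rpow' (by linarith)).const_mul _
        rw [lintegral_mul_const _ (by fun_prop), ρ.volume_ball hr,
          ← ofReal_integral_eq_lintegral_ofReal
            ((intervalIntegrable_iff_integrableOn_Ioc_of_le hr.le).1 hI),
          ← intervalIntegral.integral_of_le hr.le, intervalIntegral.integral_const_mul,
          integral_rpow (Or.inl (by linarith)), sub_add_cancel, Real.zero_rpow hQ.ne', ← hQd]
        · congr 2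
          field_simp
          simp
        · filter_upwards [ae_restrict_mem measurableSet_Ioc] with t ht
          have : 0 < t := ht.1
          positivity

/-! ### The geometric mean over a ball -/

/-- The geometric mean of `h` over the ball of radius `r`. -/
noncomputable def ballMean (ρ : G.QuasiNorm) (h : EuclideanSpace ℝ (Fin N) → ℝ≥0∞) (r : ℝ) :
    ℝ≥0∞ :=
  expMean (∫⁻ y in ρ.ball r, (ENNReal.log (h y)).toENNReal)
    (∫⁻ y in ρ.ball r, (-ENNReal.log (h y)).toENNReal) (volume (ρ.ball r))

/-- Away from the origin, `geomMean` is a radial function with the measurable profile `ballMean`. -/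
theorem geomMean_eq (hN : 0 < N) (ρ : G.QuasiNorm) (h : EuclideanSpace ℝ (Fin N) → ℝ≥0∞)
    {x : EuclideanSpace ℝ (Fin N)} (hx : 0 < ρ.toFun x) :
    ρ.geomMean h x = ρ.ballMean h (ρ.toFun x) := by
  rw [ballMean, ← expMean_eq (ρ.volume_ball_pos hx).ne' (ρ.volume_ball_ne_top hN _), geomMean,
    logIntegral]

theorem measurable_ballMean (ρ : G.QuasiNorm) (h : EuclideanSpace ℝ (Fin N) → ℝ≥0∞) :
    Measurable (ρ.ballMean h) := by
  have hm : ∀ F : EuclideanSpace ℝ (Fin N) → ℝ≥0∞, Measurable fun r => ∫⁻ y in ρ.ball r, F y :=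
    fun F => Monotone.measurable fun _ _ hrt => lintegral_mono_set (ρ.ball_mono hrt)
  exact measurable_expMean (hm _) (hm _)
    (Monotone.measurable fun _ _ hrt => measure_mono (ρ.ball_mono hrt))

theorem lintegral_log_ne_top_of_ballMean_ne_top {ρ : G.QuasiNorm}
    {h : EuclideanSpace ℝ (Fin N) → ℝ≥0∞} {r : ℝ} (hh : ρ.ballMean h r ≠ ⊤) :
    ∫⁻ y in ρ.ball r, (ENNReal.log (h y)).toENNReal ≠ ⊤ := fun ht => hh (by
  rw [ballMean, expMean, if_pos ht])

/-- A zero of `v` is a point where `log (1 / v) = ∞`. -/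
theorem ae_ne_zero_of_ballMean_ne_top {ρ : G.QuasiNorm} {v : EuclideanSpace ℝ (Fin N) → ℝ≥0}
    (hv : Measurable v) {r : ℝ} (hh : ρ.ballMean (fun y => 1 / (v y : ℝ≥0∞)) r ≠ ⊤) :
    ∀ᵐ y ∂volume.restrict (ρ.ball r), v y ≠ 0 := by
  have hm : Measurable fun y => 1 / (v y : ℝ≥0∞) := by
    simp_rw [one_div]
    exact hv.coe_nnreal_ennreal.inv
  filter_upwards [ae_lt_top (measurable_toENNReal_log hm)
    (lintegral_log_ne_top_of_ballMean_ne_top hh)] with y hy h0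
  simp [h0] at hy

/-- The pointwise bound for the geometric mean of `f` by an arithmetic mean of `f ^ p * v` with
the additional weight `|B(0,|y|)|`. -/
theorem ballMean_rpow_le (hN : 0 < N) (ρ : G.QuasiNorm) {p : ℝ} (hp : 0 < p)
    {f v : EuclideanSpace ℝ (Fin N) → ℝ≥0} (hf : Measurable f) (hf0 : ∀ x, 0 < f x)
    (hv : Measurable v) {r : ℝ} (hr : 0 < r)
    (hGv : ρ.ballMean (fun y => 1 / (v y : ℝ≥0∞)) r ≠ ⊤)
    (hT : ∫⁻ y in ρ.ball r, volume (ρ.ball (ρ.toFun y)) * ((f y : ℝ≥0∞) ^ p * v y) ≠ ⊤) :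
    ρ.ballMean (fun y => (f y : ℝ≥0∞)) r ^ p ≤
      ρ.ballMean (fun y => 1 / (v y : ℝ≥0∞)) r * (ENNReal.ofReal (Real.exp 1) *
        ((∫⁻ y in ρ.ball r, volume (ρ.ball (ρ.toFun y)) * ((f y : ℝ≥0∞) ^ p * v y)) *
          (volume (ρ.ball r) ^ 2)⁻¹)) := by
  have hQ := homDim_pos hN G
  set T := ∫⁻ y in ρ.ball r, volume (ρ.ball (ρ.toFun y)) * ((f y : ℝ≥0∞) ^ p * v y) with hTd
  set V := volume (ρ.ball r) with hVd
  have hV0 : V ≠ 0 := (ρ.volume_ball_pos hr).ne'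
  have hVt : V ≠ ⊤ := ρ.volume_ball_ne_top hN r
  set μ : Measure (EuclideanSpace ℝ (Fin N)) := volume.restrict (ρ.ball r) with hμd
  have hμV : μ Set.univ = V := by simp [hμd, hVd]
  have hμ : μ ≠ 0 := fun h => hV0 (by rw [← hμV, h]; simp)
  have : IsFiniteMeasure μ := ⟨by rw [hμV]; exact hVt.lt_top⟩
  have hav := lintegral_log_ne_top_of_ballMean_ne_top hGv
  have hv0 : ∀ᵐ y ∂μ, v y ≠ 0 := ae_ne_zero_of_ballMean_ne_top hv hGv
  have hρ0 : ∀ᵐ y ∂μ, 0 < ρ.toFun y := ae_restrict_of_ae (ρ.ae_toFun_pos hN)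
  have hρr : ∀ᵐ y ∂μ, ρ.toFun y < r := ae_restrict_mem (ρ.measurableSet_ball r)
  have ekp : ∫⁻ y, (ENNReal.log (1 / (v y : ℝ≥0∞))).toENNReal ∂μ =
      ∫⁻ y, ENNReal.ofReal (-Real.log (v y)) ∂μ :=
    lintegral_congr_ae (hv0.mono fun y hy => toENNReal_log_one_div_coe hy)
  have ekm : ∫⁻ y, (-ENNReal.log (1 / (v y : ℝ≥0∞))).toENNReal ∂μ =
      ∫⁻ y, ENNReal.ofReal (- -Real.log (v y)) ∂μ :=
    lintegral_congr_ae (hv0.mono fun y hy => by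
      simpa only [neg_neg] using toENNReal_neg_log_one_div_coe hy)
  have elp : ∫⁻ y, (ENNReal.log (f y : ℝ≥0∞)).toENNReal ∂μ =
      ∫⁻ y, ENNReal.ofReal (Real.log (f y)) ∂μ :=
    lintegral_congr fun y => toENNReal_log_coe (hf0 y).ne'
  have elm : ∫⁻ y, (-ENNReal.log (f y : ℝ≥0∞)).toENNReal ∂μ =
      ∫⁻ y, ENNReal.ofReal (-Real.log (f y)) ∂μ :=
    lintegral_congr fun y => toENNReal_neg_log_coe (hf0 y).ne'
  have hgm : Measurable fun y => (f y : ℝ≥0∞) ^ p * (v y : ℝ≥0∞) :=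
    (hf.coe_nnreal_ennreal.pow_const p).mul hv.coe_nnreal_ennreal
  have hwgm : Measurable fun y => volume (ρ.ball (ρ.toFun y)) * ((f y : ℝ≥0∞) ^ p * v y) :=
    ρ.measurable_volume_ball.mul hgm
  have hρm := ρ.measurable_toFun
  -- `c = T / V ^ 2` has to be positive to serve as the point of tangency.
  have hTne : T ≠ 0 := fun h => by
    rw [hTd, lintegral_eq_zero_iff hwgm] at h
    have : NeZero μ := ⟨hμ⟩
    obtain ⟨y, h1, h2, h3⟩ := (h.and (hv0.and hρ0)).exists
    have h4 : (f y : ℝ≥0∞) ^ p ≠ 0 := by simp [ENNReal.rpow_eq_zero_iff, (hf0 y).ne']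
    have h5 : (v y : ℝ≥0∞) ≠ 0 := by simpa using h2
    exact mul_ne_zero (ρ.volume_ball_pos h3).ne' (mul_ne_zero h4 h5) h1
  have hcT : T * (V ^ 2)⁻¹ ≠ ⊤ :=
    ENNReal.mul_ne_top hT (ENNReal.inv_ne_top.2 (pow_ne_zero _ hV0))
  have hc0 : T * (V ^ 2)⁻¹ ≠ 0 :=
    mul_ne_zero hTne (ENNReal.inv_ne_zero.2 (ENNReal.pow_ne_top hVt))
  set H : EuclideanSpace ℝ (Fin N) → ℝ :=
    fun y => (f y : ℝ) ^ p * v y * (ρ.toFun y / r) ^ G.homDim with hHd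
  have hH : ∀ᵐ y ∂μ, ENNReal.ofReal (H y) =
      volume (ρ.ball (ρ.toFun y)) * ((f y : ℝ≥0∞) ^ p * v y) * V⁻¹ := by
    filter_upwards [hρ0] with y hy
    have hb0 := ρ.volume_ball_one_pos.ne'
    have hbt := (ρ.volume_ball_one_lt_top hN).ne
    have hrQ : 0 < r ^ G.homDim := by positivity
    simp only [hHd]
    rw [hVd, ρ.volume_ball hr, ρ.volume_ball hy, ENNReal.mul_inv (Or.inr hbt) (Or.inr hb0),
      Real.div_rpow hy.le hr.le, div_eq_mul_inv, ENNReal.ofReal_mul (by positivity),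
      ENNReal.ofReal_mul (by positivity), ENNReal.ofReal_mul (by positivity),
      ENNReal.ofReal_inv_of_pos hrQ, ← ENNReal.ofReal_rpow_of_nonneg (by positivity) hp.le,
      ENNReal.ofReal_coe_nnreal, ENNReal.ofReal_coe_nnreal]
    calc _ = (f y : ℝ≥0∞) ^ p * v y * (ENNReal.ofReal (ρ.toFun y ^ G.homDim) *
          (ENNReal.ofReal (r ^ G.homDim))⁻¹) *
          (volume (ρ.ball 1) * (volume (ρ.ball 1))⁻¹) := by
            rw [ENNReal.mul_inv_cancel hb0 hbt, mul_one]
      _ = _ := by ring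
  have key := expMean_rpow_le (μ := μ) hμ hp (c := (T * (V ^ 2)⁻¹).toReal)
    (ENNReal.toReal_pos hc0 hcT)
    (l := fun y => Real.log (f y)) (k := fun y => -Real.log (v y))
    (ℓ := fun y => G.homDim * Real.log (r / ρ.toFun y)) (H := H)
    (by fun_prop) (by fun_prop) (by fun_prop) (by fun_prop)
    (by
      filter_upwards [hρ0, hρr] with y h1 h2
      exact mul_nonneg hQ.le (Real.log_nonneg ((one_le_div h1).2 h2.le)))
    (by
      filter_upwards [hρ0, hv0] with y h1 h2
      have := hf0 y
      have h3 : 0 < v y := pos_iff_ne_zero.2 h2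
      positivity)
    (by
      filter_upwards [hρ0, hv0] with y h1 h2
      have h3 : (0 : ℝ) < f y := hf0 y
      have h4 : (0 : ℝ) < v y := NNReal.coe_pos.2 (pos_iff_ne_zero.2 h2)
      rw [hHd]
      dsimp only
      rw [Real.log_mul (by positivity) (by positivity), Real.log_mul (by positivity) h4.ne',
        Real.log_rpow h3, Real.log_rpow (by positivity), Real.log_div h1.ne' hr.ne',
        Real.log_div hr.ne' h1.ne']
      ring)
    (by
      rw [lintegral_congr_ae hH, lintegral_mul_const _ hwgm, ← hTd,
        ENNReal.ofReal_toReal hcT, hμV, sq, ENNReal.mul_inv (Or.inl hV0) (Or.inl hVt)]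
      apply le_of_eq
      calc T * V⁻¹ = T * V⁻¹ * (V⁻¹ * V) := by rw [ENNReal.inv_mul_cancel hV0 hVt, mul_one]
        _ = _ := by ring)
    (by rw [hμV]; exact (ρ.lintegral_ball_log hN hr).le)
    (by rw [← ekp]; exact hav)
  rw [← ekp, ← ekm, ← elp, ← elm, hμV, ENNReal.ofReal_mul (Real.exp_pos 1).le,
    ENNReal.ofReal_toReal hcT] at key
  exact key

theorem lintegral_hardy (hN : 0 < N) (ρ : G.QuasiNorm) {g : EuclideanSpace ℝ (Fin N) → ℝ≥0∞}
    (hg : Measurable g) {s : ℝ} (hs : 1 ≤ s) :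
    ∫⁻ x, volume (ρ.ball (ρ.toFun x)) ^ (-s - 1) *
        (∫⁻ y in ρ.ball (ρ.toFun x), volume (ρ.ball (ρ.toFun y)) * g y) ^ s ≤
      (ENNReal.ofReal s)⁻¹ * (∫⁻ y, g y) ^ s := by
  have hset : ∀ x, {y | volume (ρ.ball (ρ.toFun y)) < volume (ρ.ball (ρ.toFun x))} =
      ρ.ball (ρ.toFun x) := fun x => Set.ext fun y => ρ.volume_ball_lt_iff hN x y
  have h := hardy_lintegral_le (μ := volume) (w := fun x => volume (ρ.ball (ρ.toFun x)))
    ρ.measurable_volume_ball hg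
    ((ρ.ae_toFun_pos hN).mono fun x hx => (ρ.volume_ball_pos hx).ne')
    (fun x => ρ.volume_ball_ne_top hN _) hs (fun t ht y hy => by
      have hy0 : 0 < ρ.toFun y := by
        by_contra! h
        exact hy (ρ.volume_ball_of_nonpos h)
      simp_rw [ρ.volume_ball_lt_iff hN]
      exact (ρ.lintegral_volume_ball_rpow_tail hN (by linarith) hy0).le)
  simp_rw [hset] at h
  exact h

theorem le_weightConst (ρ : G.QuasiNorm) (p q : ℝ) (u v : EuclideanSpace ℝ (Fin N) → ℝ≥0)
    {x : EuclideanSpace ℝ (Fin N)} (hx : x ≠ 0) :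
    volume (ρ.ball (ρ.toFun x)) ^ (1 / q - 1 / p) * ρ.sphericalAverage u x ^ (1 / q) *
      ρ.geomMean (fun y => 1 / (v y : ℝ≥0∞)) x ^ (1 / p) ≤ ρ.weightConst p q u v :=
  le_iSup₂_of_le (f := fun (x : EuclideanSpace ℝ (Fin N)) (_ : x ≠ 0) =>
    volume (ρ.ball (ρ.toFun x)) ^ (1 / q - 1 / p) * ρ.sphericalAverage u x ^ (1 / q) *
    ρ.geomMean (fun y => 1 / (v y : ℝ≥0∞)) x ^ (1 / p)) x hx le_rfl

theorem geomMean_one_div_ne_top (hN : 0 < N) (ρ : G.QuasiNorm) {p q : ℝ} (hp : 0 < p)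
    (hq : 0 < q) {u v : EuclideanSpace ℝ (Fin N) → ℝ≥0} (hD : ρ.weightConst p q u v ≠ ⊤)
    {x : EuclideanSpace ℝ (Fin N)} (hx : x ≠ 0) (hu : ρ.sphericalAverage u x ≠ 0) :
    ρ.geomMean (fun y => 1 / (v y : ℝ≥0∞)) x ≠ ⊤ := fun h => by
  refine hD (top_le_iff.1 (le_trans (le_of_eq ?_) (ρ.le_weightConst p q u v hx)))
  rw [h, ENNReal.top_rpow_of_pos (by positivity), ENNReal.mul_top]
  refine mul_ne_zero ?_ ?_
  · simp [ENNReal.rpow_eq_zero_iff, (ρ.volume_ball_pos (ρ.toFun_pos hx)).ne',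
      ρ.volume_ball_ne_top hN]
  · simp [ENNReal.rpow_eq_zero_iff, hu, hq.le]

/-- The pointwise bound after the factor `𝒢(1/v) ^ (q / p) * u₁` has been absorbed in `D_Q ^ q`. -/
theorem geomMean_rpow_mul_sphericalAverage_le (hN : 0 < N) (ρ : G.QuasiNorm) {p q : ℝ}
    (hp : 0 < p) (hpq : p ≤ q) {u f v : EuclideanSpace ℝ (Fin N) → ℝ≥0}
    (hf : Measurable f) (hf0 : ∀ x, 0 < f x) (hv : Measurable v)
    (hD : ρ.weightConst p q u v ≠ ⊤) (hI : ∫⁻ y, (f y : ℝ≥0∞) ^ p * v y ≠ ⊤)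
    {x : EuclideanSpace ℝ (Fin N)} (hx : 0 < ρ.toFun x) :
    ρ.geomMean (fun y => (f y : ℝ≥0∞)) x ^ q * ρ.sphericalAverage u x ≤
      ρ.weightConst p q u v ^ q * ENNReal.ofReal (Real.exp 1) ^ (q / p) *
        (volume (ρ.ball (ρ.toFun x)) ^ (-(q / p) - 1) *
          (∫⁻ y in ρ.ball (ρ.toFun x),
            volume (ρ.ball (ρ.toFun y)) * ((f y : ℝ≥0∞) ^ p * v y)) ^ (q / p)) := by
  have hq : 0 < q := hp.trans_le hpq
  have hs : 0 < q / p := div_pos hq hp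
  set w := volume (ρ.ball (ρ.toFun x)) with hw
  have hw0 : w ≠ 0 := (ρ.volume_ball_pos hx).ne'
  have hwt : w ≠ ⊤ := ρ.volume_ball_ne_top hN _
  -- The convention `0 * ∞ = 0` in `D_Q` is harmless: if `u₁(x) = 0`, the left-hand side vanishes.
  rcases eq_or_ne (ρ.sphericalAverage u x) 0 with hu0 | hu0
  · simp [hu0]
  set T := ∫⁻ y in ρ.ball (ρ.toFun x),
    volume (ρ.ball (ρ.toFun y)) * ((f y : ℝ≥0∞) ^ p * v y) with hTd
  set Gv := ρ.geomMean (fun y => 1 / (v y : ℝ≥0∞)) x with hGv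
  have hx0 : x ≠ 0 := by
    rintro rfl
    rw [(ρ.eq_zero_iff 0).2 rfl] at hx
    exact hx.false
  have hDx : w ^ (1 / q - 1 / p) * ρ.sphericalAverage u x ^ (1 / q) * Gv ^ (1 / p) ≤
      ρ.weightConst p q u v := ρ.le_weightConst p q u v hx0
  have hGvt : Gv ≠ ⊤ := ρ.geomMean_one_div_ne_top hN hp hq hD hx0 hu0
  -- On the ball the weight `|B(0,|y|)|` is at most `w`.
  have hT : T ≠ ⊤ := by
    refine ne_top_of_le_ne_top (ENNReal.mul_ne_top hwt hI) (?_ : T ≤ w * _)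
    have hgm : Measurable fun y => (f y : ℝ≥0∞) ^ p * (v y : ℝ≥0∞) :=
      (hf.coe_nnreal_ennreal.pow_const p).mul hv.coe_nnreal_ennreal
    calc T ≤ ∫⁻ y in ρ.ball (ρ.toFun x), w * ((f y : ℝ≥0∞) ^ p * v y) := by
          refine setLIntegral_mono (hgm.const_mul _) fun y hy => ?_
          exact mul_le_mul_left (measure_mono (ρ.ball_mono (le_of_lt hy))) _
      _ = w * ∫⁻ y in ρ.ball (ρ.toFun x), (f y : ℝ≥0∞) ^ p * v y := lintegral_const_mul _ hgm
      _ ≤ _ := by gcongr; exact Measure.restrict_le_self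
  have hmean := ρ.ballMean_rpow_le hN hp hf hf0 hv hx (by rwa [← ρ.geomMean_eq hN _ hx]) hT
  rw [← ρ.geomMean_eq hN _ hx, ← ρ.geomMean_eq hN _ hx, ← hGv, ← hTd, ← hw] at hmean
  have hDq : w ^ (1 - q / p) * ρ.sphericalAverage u x * Gv ^ (q / p) ≤
      ρ.weightConst p q u v ^ q := by
    refine le_trans (le_of_eq ?_) (ENNReal.rpow_le_rpow hDx hq.le)
    rw [ENNReal.mul_rpow_of_nonneg _ _ hq.le, ENNReal.mul_rpow_of_nonneg _ _ hq.le,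
      ← ENNReal.rpow_mul, ← ENNReal.rpow_mul, ← ENNReal.rpow_mul, one_div_mul_cancel hq.ne',
      ENNReal.rpow_one]
    congr 3 <;> field_simp
  calc ρ.geomMean (fun y => (f y : ℝ≥0∞)) x ^ q * ρ.sphericalAverage u x
      = (ρ.geomMean (fun y => (f y : ℝ≥0∞)) x ^ p) ^ (q / p) * ρ.sphericalAverage u x := by
        rw [← ENNReal.rpow_mul, mul_div_cancel₀ _ hp.ne']
    _ ≤ (Gv * (ENNReal.ofReal (Real.exp 1) * (T * (w ^ 2)⁻¹))) ^ (q / p) *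
        ρ.sphericalAverage u x := by gcongr
    _ = (w ^ (1 - q / p) * ρ.sphericalAverage u x * Gv ^ (q / p)) *
        ENNReal.ofReal (Real.exp 1) ^ (q / p) * (w ^ (-(q / p) - 1) * T ^ (q / p)) := by
        have : ((w ^ 2)⁻¹) ^ (q / p) = w ^ (1 - q / p) * w ^ (-(q / p) - 1) := by
          rw [← ENNReal.rpow_add _ _ hw0 hwt, ← ENNReal.rpow_natCast, ← ENNReal.rpow_neg,
            ← ENNReal.rpow_mul]
          congr 1; push_cast; ring
        rw [ENNReal.mul_rpow_of_nonneg _ _ hs.le, ENNReal.mul_rpow_of_nonneg _ _ hs.le,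
          ENNReal.mul_rpow_of_nonneg _ _ hs.le, this]
        ring
    _ ≤ _ := by gcongr

theorem lintegral_geomMean_rpow_le (hN : 0 < N) (ρ : G.QuasiNorm) {p q : ℝ}
    (hp : 0 < p) (hpq : p ≤ q) {u f v : EuclideanSpace ℝ (Fin N) → ℝ≥0} (hu : Measurable u)
    (hf : Measurable f) (hf0 : ∀ x, 0 < f x) (hv : Measurable v)
    (hD : ρ.weightConst p q u v ≠ ⊤) (hI : ∫⁻ y, (f y : ℝ≥0∞) ^ p * v y ≠ ⊤) :
    ∫⁻ x, ρ.geomMean (fun y => (f y : ℝ≥0∞)) x ^ q * u x ≤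
      ρ.weightConst p q u v ^ q * ENNReal.ofReal (Real.exp 1) ^ (q / p) *
        ((ENNReal.ofReal (q / p))⁻¹ * (∫⁻ y, (f y : ℝ≥0∞) ^ p * v y) ^ (q / p)) := by
  have hq : 0 < q := hp.trans_le hpq
  have hs : 0 < q / p := div_pos hq hp
  have hae := ρ.ae_toFun_pos hN
  have hgm : Measurable fun y => (f y : ℝ≥0∞) ^ p * (v y : ℝ≥0∞) :=
    (hf.coe_nnreal_ennreal.pow_const p).mul hv.coe_nnreal_ennreal
  calc ∫⁻ x, ρ.geomMean (fun y => (f y : ℝ≥0∞)) x ^ q * u x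
      = ∫⁻ x, ρ.ballMean (fun y => (f y : ℝ≥0∞)) (ρ.toFun x) ^ q * u x :=
        lintegral_congr_ae (hae.mono fun x hx => by simp only [ρ.geomMean_eq hN _ hx])
    _ = ∫⁻ x, ρ.ballMean (fun y => (f y : ℝ≥0∞)) (ρ.toFun x) ^ q * ρ.sphericalAverage u x :=
        ρ.lintegral_radial_mul hN
          (Φ := fun r => ρ.ballMean (fun y => (f y : ℝ≥0∞)) r ^ q)
          ((ρ.measurable_ballMean _).pow_const _) hu
    _ ≤ ∫⁻ x, ρ.weightConst p q u v ^ q * ENNReal.ofReal (Real.exp 1) ^ (q / p) *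
        (volume (ρ.ball (ρ.toFun x)) ^ (-(q / p) - 1) *
          (∫⁻ y in ρ.ball (ρ.toFun x),
            volume (ρ.ball (ρ.toFun y)) * ((f y : ℝ≥0∞) ^ p * v y)) ^ (q / p)) := by
        refine lintegral_mono_ae (hae.mono fun x hx => ?_)
        rw [← ρ.geomMean_eq hN _ hx]
        exact ρ.geomMean_rpow_mul_sphericalAverage_le hN hp hpq hf hf0 hv hD hI hx
    _ = ρ.weightConst p q u v ^ q * ENNReal.ofReal (Real.exp 1) ^ (q / p) *
        ∫⁻ x, (volume (ρ.ball (ρ.toFun x)) ^ (-(q / p) - 1) *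
          (∫⁻ y in ρ.ball (ρ.toFun x),
            volume (ρ.ball (ρ.toFun y)) * ((f y : ℝ≥0∞) ^ p * v y)) ^ (q / p)) :=
        lintegral_const_mul' _ _ (ENNReal.mul_ne_top (ENNReal.rpow_ne_top_of_nonneg hq.le hD)
          (ENNReal.rpow_ne_top_of_nonneg hs.le ENNReal.ofReal_ne_top))
    _ ≤ _ := by
        gcongr
        exact ρ.lintegral_hardy hN hgm ((one_le_div hp).2 hpq)

/-! ### The weighted inequality and its optimal constant -/

theorem geomMeanInequality_of_le (hN : 0 < N) (ρ : G.QuasiNorm) {p q : ℝ}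
    (hp : 0 < p) (hpq : p ≤ q) {u v : EuclideanSpace ℝ (Fin N) → ℝ≥0} (hu : Measurable u)
    (hv : Measurable v) (hD : ρ.weightConst p q u v ≠ ⊤) {C : ℝ≥0} (hC0 : 0 < C)
    (hC : ENNReal.ofReal ((p / q) ^ (1 / q) * Real.exp (1 / p)) * ρ.weightConst p q u v ≤ C) :
    ρ.GeomMeanInequality p q u v C := by
  intro f hf hf0
  have hq : 0 < q := hp.trans_le hpq
  have hs : 0 < q / p := div_pos hq hp
  set I := ∫⁻ x, (f x : ℝ≥0∞) ^ p * (v x : ℝ≥0∞) with hId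
  rcases eq_or_ne I ⊤ with hI | hI
  · rw [hI, ENNReal.top_rpow_of_pos (by positivity), ENNReal.mul_top (by simpa using hC0.ne')]
    exact le_top
  have h := ENNReal.rpow_le_rpow
    (ρ.lintegral_geomMean_rpow_le hN hp hpq hu hf hf0 hv hD hI) (by positivity : 0 ≤ 1 / q)
  refine h.trans (le_trans (le_of_eq ?_) (mul_le_mul_left hC _))
  have hq' : (0 : ℝ) ≤ 1 / q := by positivity
  rw [← hId, ENNReal.mul_rpow_of_nonneg _ _ hq', ENNReal.mul_rpow_of_nonneg _ _ hq',
    ENNReal.mul_rpow_of_nonneg _ _ hq', ← ENNReal.rpow_mul, ← ENNReal.rpow_mul,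
    ← ENNReal.rpow_mul, mul_one_div_cancel hq.ne', ENNReal.rpow_one,
    ENNReal.ofReal_rpow_of_pos (Real.exp_pos _), ← Real.exp_mul, ← ENNReal.ofReal_inv_of_pos hs,
    inv_div, ENNReal.ofReal_rpow_of_pos (by positivity), ENNReal.ofReal_mul (by positivity),
    one_mul]
  have : q / p * (1 / q) = 1 / p := by field_simp
  rw [this]
  ring

theorem sphericalAverage_ne_zero (hN : 0 < N) (ρ : G.QuasiNorm)
    {u : EuclideanSpace ℝ (Fin N) → ℝ≥0} (hu : Measurable u) (hu0 : ∀ x, 0 < u x)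
    (x : EuclideanSpace ℝ (Fin N)) : ρ.sphericalAverage u x ≠ 0 := by
  refine mul_ne_zero (ENNReal.inv_ne_zero.2 (ρ.sphereMeasure_sphere_ne_top hN)) fun h => ?_
  have hm : Measurable fun y => (u (G.dil (ρ.toFun x) y) : ℝ≥0∞) :=
    (hu.comp ((measurable_dil G).comp
      (measurable_const.prodMk measurable_id))).coe_nnreal_ennreal
  rw [lintegral_eq_zero_iff hm] at h
  have : NeZero (ρ.sphereMeasure.restrict ρ.sphere) :=
    ⟨fun h => ρ.sphereMeasure_sphere_ne_zero hN (by simpa using h)⟩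
  obtain ⟨y, hy⟩ := h.exists
  simp [(hu0 _).ne'] at hy

/-- A function for which the right-hand side of the inequality is finite, and whose logarithm has
an integrable negative part on the ball of radius `r`. -/
theorem exists_testFunction (hN : 0 < N) (ρ : G.QuasiNorm) {p : ℝ} (hp : 0 < p)
    {v : EuclideanSpace ℝ (Fin N) → ℝ≥0} (hv : Measurable v) {r : ℝ} (hr : 0 < r)
    (ht : ρ.ballMean (fun y => 1 / (v y : ℝ≥0∞)) r ≠ ⊤)
    (h0 : ρ.ballMean (fun y => 1 / (v y : ℝ≥0∞)) r ≠ 0) :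
    ∃ f : EuclideanSpace ℝ (Fin N) → ℝ≥0, Measurable f ∧ (∀ x, 0 < f x) ∧
      ∫⁻ x, (f x : ℝ≥0∞) ^ p * v x ≠ ⊤ ∧
      ∫⁻ y in ρ.ball r, (-ENNReal.log (f y : ℝ≥0∞)).toENNReal ≠ ⊤ := by
  classical
  set w := fun y => volume (ρ.ball (ρ.toFun y)) with hw
  have hwm : Measurable w := ρ.measurable_volume_ball
  have hwt : ∀ y, w y ≠ ⊤ := fun y => ρ.volume_ball_ne_top hN _
  have hw0 : ∀ y, r ≤ ρ.toFun y → w y ≠ 0 := fun y hy =>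
    (ρ.volume_ball_pos (hr.trans_le hy)).ne'
  -- `f ^ p * v` is to equal this positive integrable function wherever `v` does not vanish.
  set ψ : EuclideanSpace ℝ (Fin N) → ℝ≥0 :=
    fun y => if ρ.toFun y < r then 1 else (w y ^ (-1 - 1 : ℝ)).toNNReal with hψ
  have hψm : Measurable ψ :=
    Measurable.ite (ρ.measurableSet_ball r) measurable_const (hwm.pow_const _).ennreal_toNNReal
  have hψ0 : ∀ y, ψ y ≠ 0 := fun y => by
    simp only [hψ]
    split_ifs with h
    · exact one_ne_zero
    · have h1 := hw0 y (not_lt.1 h)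
      simp [ENNReal.toNNReal_eq_zero_iff, h1, hwt y]
  have hψi : ∫⁻ y, (ψ y : ℝ≥0∞) ≠ ⊤ := by
    have hS : MeasurableSet {y | r / 2 < ρ.toFun y} :=
      measurableSet_lt measurable_const ρ.measurable_toFun
    have hle : ∀ y, (ψ y : ℝ≥0∞) ≤ (ρ.ball r).indicator 1 y +
        {y | r / 2 < ρ.toFun y}.indicator (fun y => w y ^ (-1 - 1 : ℝ)) y := fun y => by
      by_cases h : ρ.toFun y < r
      · have h1 : y ∈ ρ.ball r := h
        simp [hψ, h, h1]
      · have h1 : y ∉ ρ.ball r := h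
        have h2 : r / 2 < ρ.toFun y := by linarith [not_lt.1 h]
        have h3 := hw0 y (not_lt.1 h)
        have h4 : w y ^ (-1 - 1 : ℝ) ≠ ⊤ := by simp [ENNReal.rpow_eq_top_iff, h3, hwt y]
        simp only [hψ, if_neg h, ENNReal.coe_toNNReal h4]
        simp [h1, h2]
    refine ne_top_of_le_ne_top ?_ (lintegral_mono hle)
    rw [lintegral_add_left (measurable_one.indicator (ρ.measurableSet_ball r)),
      lintegral_indicator_one (ρ.measurableSet_ball r), lintegral_indicator hS,
      ρ.lintegral_volume_ball_rpow_tail hN one_pos (half_pos hr)]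
    refine ENNReal.add_ne_top.2 ⟨ρ.volume_ball_ne_top hN r, ENNReal.mul_ne_top ?_ (by simp)⟩
    have h3 := (ρ.volume_ball_pos (half_pos hr)).ne'
    simp [ENNReal.rpow_neg_one, h3]
  refine ⟨fun y => if v y = 0 then 1 else (ψ y / v y) ^ (1 / p), ?_, ?_, ?_, ?_⟩
  · exact Measurable.ite (hv (measurableSet_singleton 0)) measurable_const
      ((hψm.div hv).pow_const _)
  · intro y
    dsimp only
    split_ifs with h
    · exact one_pos
    · exact NNReal.rpow_pos (div_pos (pos_iff_ne_zero.2 (hψ0 y)) (pos_iff_ne_zero.2 h))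
  · refine ne_top_of_le_ne_top hψi (lintegral_mono fun y => ?_)
    dsimp only
    split_ifs with h
    · simp [h]
    · rw [← ENNReal.coe_rpow_of_nonneg _ hp.le, ← NNReal.rpow_mul, one_div_mul_cancel hp.ne',
        NNReal.rpow_one, ← ENNReal.coe_mul, div_mul_cancel₀ _ h]
  · have hb : ∫⁻ y in ρ.ball r, (-ENNReal.log (1 / (v y : ℝ≥0∞))).toENNReal ≠ ⊤ := fun h => by
      refine h0 ?_
      rw [ballMean, expMean, if_neg (lintegral_log_ne_top_of_ballMean_ne_top ht), if_pos h]
    have hv0 := ae_ne_zero_of_ballMean_ne_top hv ht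
    have hmem : ∀ᵐ y ∂volume.restrict (ρ.ball r), y ∈ ρ.ball r :=
      ae_restrict_mem (ρ.measurableSet_ball r)
    refine ne_top_of_le_ne_top (ENNReal.mul_ne_top (ENNReal.ofReal_ne_top (r := 1 / p)) hb) ?_
    rw [← lintegral_const_mul' _ _ ENNReal.ofReal_ne_top]
    refine lintegral_mono_ae ?_
    filter_upwards [hv0, hmem] with y hy hyr
    have h1 : ρ.toFun y < r := hyr
    have h2 : (1 / v y) ^ (1 / p) ≠ 0 :=
      (NNReal.rpow_pos (div_pos one_pos (pos_iff_ne_zero.2 hy))).ne'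
    simp only [if_neg hy, hψ, if_pos h1]
    rw [toENNReal_neg_log_coe h2, toENNReal_neg_log_one_div_coe hy,
      ← ENNReal.ofReal_mul (by positivity), NNReal.coe_rpow, NNReal.coe_div, NNReal.coe_one,
      Real.log_rpow (by positivity), one_div (v y : ℝ), Real.log_inv]
    exact ENNReal.ofReal_le_ofReal (by linarith)

theorem lintegral_geomMean_rpow_ne_zero (hN : 0 < N) (ρ : G.QuasiNorm) {q : ℝ} (hq : 0 < q)
    {u f : EuclideanSpace ℝ (Fin N) → ℝ≥0} (hu : Measurable u) (hu0 : ∀ x, 0 < u x)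
    {r : ℝ} (hr : 0 < r)
    (hb : ∫⁻ y in ρ.ball r, (-ENNReal.log (f y : ℝ≥0∞)).toENNReal ≠ ⊤) :
    ∫⁻ x, ρ.geomMean (fun y => (f y : ℝ≥0∞)) x ^ q * u x ≠ 0 := by
  have hae := ρ.ae_toFun_pos hN
  intro h
  have h' : ∫⁻ x, ρ.ballMean (fun y => (f y : ℝ≥0∞)) (ρ.toFun x) ^ q * u x = 0 := by
    rw [← h]
    exact lintegral_congr_ae (hae.mono fun x hx => by simp only [ρ.geomMean_eq hN _ hx])
  have hm : Measurable fun x => ρ.ballMean (fun y => (f y : ℝ≥0∞)) (ρ.toFun x) ^ q * u x :=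
    (((ρ.measurable_ballMean _).comp ρ.measurable_toFun).pow_const q).mul hu.coe_nnreal_ennreal
  rw [lintegral_eq_zero_iff hm] at h'
  have : NeZero (volume.restrict (ρ.ball r)) :=
    ⟨fun h => (ρ.volume_ball_pos hr).ne' (by simpa using h)⟩
  have hmem : ∀ᵐ y ∂volume.restrict (ρ.ball r), y ∈ ρ.ball r :=
    ae_restrict_mem (ρ.measurableSet_ball r)
  obtain ⟨x, h1, h2⟩ := ((ae_restrict_of_ae h').and hmem).exists
  have hbx : ∫⁻ y in ρ.ball (ρ.toFun x), (-ENNReal.log (f y : ℝ≥0∞)).toENNReal ≠ ⊤ :=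
    ne_top_of_le_ne_top hb (lintegral_mono_set (ρ.ball_mono (le_of_lt h2)))
  have hne : ρ.ballMean (fun y => (f y : ℝ≥0∞)) (ρ.toFun x) ≠ 0 := by
    rw [ballMean, expMean, if_neg hbx]
    split_ifs
    · simp
    · simpa using Real.exp_pos _
  refine mul_ne_zero ?_ ?_ h1
  · simp [ENNReal.rpow_eq_zero_iff, hne, hq.le]
  · simpa using (hu0 x).ne'

theorem optimalConst_pos (hN : 0 < N) (ρ : G.QuasiNorm) {p q : ℝ} (hp : 0 < p) (hpq : p ≤ q)
    {u v : EuclideanSpace ℝ (Fin N) → ℝ≥0} (hu : Measurable u) (hv : Measurable v)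
    (hD : ρ.weightConst p q u v ≠ ⊤) (hu0 : ∀ x, 0 < u x) (hD0 : 0 < ρ.weightConst p q u v) :
    0 < ρ.optimalConst p q u v := by
  have hq : 0 < q := hp.trans_le hpq
  obtain ⟨x, hx⟩ := lt_iSup_iff.1 hD0
  obtain ⟨hx0, hx⟩ := lt_iSup_iff.1 hx
  have hρ := ρ.toFun_pos hx0
  have ht : ρ.ballMean (fun y => 1 / (v y : ℝ≥0∞)) (ρ.toFun x) ≠ ⊤ := by
    rw [← ρ.geomMean_eq hN _ hρ]
    exact ρ.geomMean_one_div_ne_top hN hp hq hD hx0 (ρ.sphericalAverage_ne_zero hN hu hu0 x)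
  have h0 : ρ.ballMean (fun y => 1 / (v y : ℝ≥0∞)) (ρ.toFun x) ≠ 0 := fun h => by
    rw [ρ.geomMean_eq hN _ hρ, h, ENNReal.zero_rpow_of_pos (by positivity), mul_zero] at hx
    exact hx.false
  obtain ⟨f, hfm, hf0, hI, hb⟩ := ρ.exists_testFunction hN hp hv hρ ht h0
  set K := (∫⁻ x, (f x : ℝ≥0∞) ^ p * v x) ^ (1 / p)
  have hK : K ≠ ⊤ := ENNReal.rpow_ne_top_of_nonneg (by positivity) hI
  set L := (∫⁻ x, ρ.geomMean (fun y => (f y : ℝ≥0∞)) x ^ q * u x) ^ (1 / q)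
  have hL : L ≠ 0 := by
    have := ρ.lintegral_geomMean_rpow_ne_zero hN hq hu hu0 hρ hb
    simp only [L, ne_eq, ENNReal.rpow_eq_zero_iff, this, false_and, false_or, not_and]
    intro _ h
    have : 0 < 1 / q := by positivity
    linarith
  refine (ENNReal.div_pos hL hK).trans_le (le_iInf₂ fun C hC => ?_)
  exact ENNReal.div_le_of_le_mul (hC.2 f hfm hf0)

end HomogeneousGroup.QuasiNorm

theorem theorem3p1 {N : ℕ} (hN : 0 < N) [Group (EuclideanSpace ℝ (Fin N))]
    [LieGroup 𝓘(ℝ, EuclideanSpace ℝ (Fin N)) ∞ (EuclideanSpace ℝ (Fin N))]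
    (G : HomogeneousGroup N) (ρ : G.QuasiNorm) (p q : ℝ) (hp : 0 < p) (hpq : p ≤ q)
    (u v : EuclideanSpace ℝ (Fin N) → ℝ≥0) (hu : Measurable u) (hv : Measurable v)
    (hD : ρ.weightConst p q u v < ⊤) :
    (∃ C : ℝ≥0, 0 < C ∧ ρ.GeomMeanInequality p q u v C) ∧
    ρ.optimalConst p q u v ≤
      ENNReal.ofReal ((p / q) ^ (1 / q) * Real.exp (1 / p)) * ρ.weightConst p q u v ∧
    ((∀ x, 0 < u x) → 0 < ρ.weightConst p q u v → 0 < ρ.optimalConst p q u v) := by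
  -- If `D_Q = 0`, the bound `K` itself is not an admissible positive constant; `K + ε` always is.
  set K := ENNReal.ofReal ((p / q) ^ (1 / q) * Real.exp (1 / p)) * ρ.weightConst p q u v with hK
  have hKt : K ≠ ⊤ := ENNReal.mul_ne_top ENNReal.ofReal_ne_top hD.ne
  have hadm : ∀ ε : ℝ≥0, 0 < ε → ρ.GeomMeanInequality p q u v (K.toNNReal + ε) := fun ε hε =>
    ρ.geomMeanInequality_of_le hN hp hpq hu hv hD.ne (by positivity) (by
      rw [← hK, ENNReal.coe_add, ENNReal.coe_toNNReal hKt]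
      exact le_self_add)
  refine ⟨⟨_, by positivity, hadm 1 one_pos⟩, ?_,
    ρ.optimalConst_pos hN hp hpq hu hv hD.ne⟩
  refine ENNReal.le_of_forall_pos_le_add fun ε hε _ => ?_
  refine (iInf₂_le (K.toNNReal + ε) ⟨by positivity, hadm ε hε⟩).trans (le_of_eq ?_)
  rw [ENNReal.coe_add, ENNReal.coe_toNNReal hKt]
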